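/- **Setting.** There are $R$ relay nodes and $D$ destination nodes, $1\le D<R$. An instance consists of real numbers $a$ (revenue per unit data rate), $C_T$ (threshold) and $P_m$ (maximum power), declared valuations $\alpha_i$ and processing powers $P_{c,i}$ of the relays $i$, and, for every pair $(i,j)$ of a relay and a destination, arbitrary real functions $\Gamma_{i,j}(P)$ (data rate) and $C_{i,j}(P)$ (interference cost) of the power $P$, together with a power $P^*_{i,j}\in[0,P_m]$ that maximizes $a\Gamma_{i,j}(P)-\alpha_i(P+P_{c,i})-C_{i,j}(P)$ over $[0,P_m]$. Let $U^*_{i,j}=a\Gamma_{i,j}(P^*_{i,j})-\alpha_i(P^*_{i,j}+P_{c,i})-C_{i,j}(P^*_{i,j})$ be the maximum. In the complete bipartite graph $G$ between relays and destinations, the edge $(i,j)$ has weight $U^*_{i,j}$ if $C_{i,j}(P^*_{i,j})\le C_T$, and $-\infty$ otherwise. The weight $w_m$ of a matching $m$ is the sum of the weights of its edges, $\mathbf M$ is the set of all (inclusion-)maximal matchings of $G$, $R_m$ is the set of relays matched by $m$, $w_{max}=\max_{m\in\mathbf M}w_m$, and $w_{max}^{-i}=\max_{m\in\mathbf M,\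 i\notin R_m}w_m$. **BS-utility-maximizing auction.** Choose $m_{max}\in\mathbf M$ of weight $w_{max}$. If $(i,j)\in m_{max}$, then relay $i$ is assigned to destination $j$, transmits at power $P^*_{i,j}$ and is paid $w_{max}-w_{max}^{-i}+\alpha_i(P^*_{i,j}+P_{c,i})$; a relay not in $R_{m_{max}}$ is paid $0$ and does not transmit (power $0$). (The payment is $+\infty$ if $w_{max}$ is finite and $w_{max}^{-i}=-\infty$; if $w_{max}=-\infty$, the payment formula has no value, and nothing is required of the payments to the assigned relays.) **Model of computation.** A unit-cost random access machine: finite programs (assignment, sequence, conditional, while loop) on natural and real variables and two-dimensional arrays of naturals and reals; addition, truncated subtraction and comparison of naturals, exact addition, subtraction, multiplication and comparison of reals, every operation, memory access, test and assignment taking one time unit. The input in memory is $R$, $D$, $a$, $C_T$, and all the $\alpha_i$, $P_{c,i}$, $P^*_{i,j}$, $\Gamma_{i,j}(P^*_{i,j})$, $C_{i,j}(P^*_{i,j})$. Let $$\mathcal H=\mathcal H(R,D)=(R+D)^2\log(R+D)+(R+D)RD,$$ the time bound of the Hungarian algorithm. **Proposition.** The auction can be computed in time $O(D\mathcal H)$,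 and a single maximum-weight matching computation in time $O(\mathcal H)$. That is, there are two programs and a constant $c$, such that for all $1\le D<R$ and all instances: 1. the first program halts after at most $c\,D\,\mathcal H$ time units, with the allocation, the payments and the transmission powers of the auction in memory; 2. for $G$, and also for each graph $G^{-i}$ obtained from $G$ by deleting a relay $i$ (whose index is then part of the input), the second program halts after at most $c\,\mathcal H$ time units, with a maximal matching of largest weight of this graph, and its weight, in memory; 3. for every relay $i$, the largest weight of a maximal matching of $G^{-i}$ equals $w_{max}^{-i}$. -/

import Mathlib

/-! ## A unit-cost random access machine over the real numbers

Programs are finite texts of a small imperative language.  A memory state consists of natural-number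
variables, real variables, and two-dimensional arrays of naturals and of reals (a cell is addressed by
the name of the array and two natural-number indices).  The operations on naturals are addition,
truncated subtraction and comparison; the operations on reals are addition, subtraction,
multiplication and comparison, all exact.  Every operation, memory access, test and assignment costs
one time unit. -/

namespace RealRAM

/-- Memory states. -/
structure State where
  natVar : ℕ → ℕ
  realVar : ℕ → ℝ
  natArr : ℕ → ℕ → ℕ → ℕ
  realArr : ℕ → ℕ → ℕ → ℝ

/-- Natural-number expressions; `get A e₁ e₂` reads the cell `(e₁, e₂)` of the array with name `A`. -/
inductive NExp where
  | lit (n : ℕ)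
  | var (x : ℕ)
  | get (A : ℕ) (e₁ e₂ : NExp)
  | add (e₁ e₂ : NExp)
  | sub (e₁ e₂ : NExp)

/-- Real expressions.  The only constants are integers. -/
inductive RExp where
  | lit (n : ℤ)
  | var (x : ℕ)
  | get (A : ℕ) (e₁ e₂ : NExp)
  | add (e₁ e₂ : RExp)
  | sub (e₁ e₂ : RExp)
  | mul (e₁ e₂ : RExp)

/-- Tests. -/
inductive BExp where
  | natEq (e₁ e₂ : NExp)
  | natLt (e₁ e₂ : NExp)
  | realLt (e₁ e₂ : RExp)
  | realLe (e₁ e₂ : RExp)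
  | neg (b : BExp)
  | conj (b₁ b₂ : BExp)

/-- Programs. -/
inductive Prog where
  | nop
  | setNat (x : ℕ) (e : NExp)
  | setReal (x : ℕ) (e : RExp)
  | putNat (A : ℕ) (e₁ e₂ : NExp) (e : NExp)
  | putReal (A : ℕ) (e₁ e₂ : NExp) (e : RExp)
  | seq (p q : Prog)
  | branch (b : BExp) (p q : Prog)
  | loop (b : BExp) (p : Prog)

def NExp.eval (s : State) : NExp → ℕ
  | .lit n => n
  | .var x => s.natVar x
  | .get A e₁ e₂ => s.natArr A (e₁.eval s) (e₂.eval s)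
  | .add e₁ e₂ => e₁.eval s + e₂.eval s
  | .sub e₁ e₂ => e₁.eval s - e₂.eval s

def NExp.cost : NExp → ℕ
  | .lit _ => 1
  | .var _ => 1
  | .get _ e₁ e₂ => e₁.cost + e₂.cost + 1
  | .add e₁ e₂ => e₁.cost + e₂.cost + 1
  | .sub e₁ e₂ => e₁.cost + e₂.cost + 1

noncomputable def RExp.eval (s : State) : RExp → ℝ
  | .lit n => (n : ℝ)
  | .var x => s.realVar x
  | .get A e₁ e₂ => s.realArr A (e₁.eval s) (e₂.eval s)
  | .add e₁ e₂ => e₁.eval s + e₂.eval s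
  | .sub e₁ e₂ => e₁.eval s - e₂.eval s
  | .mul e₁ e₂ => e₁.eval s * e₂.eval s

def RExp.cost : RExp → ℕ
  | .lit _ => 1
  | .var _ => 1
  | .get _ e₁ e₂ => e₁.cost + e₂.cost + 1
  | .add e₁ e₂ => e₁.cost + e₂.cost + 1
  | .sub e₁ e₂ => e₁.cost + e₂.cost + 1
  | .mul e₁ e₂ => e₁.cost + e₂.cost + 1

def BExp.Holds (s : State) : BExp → Prop
  | .natEq e₁ e₂ => e₁.eval s = e₂.eval s
  | .natLt e₁ e₂ => e₁.eval s < e₂.eval s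
  | .realLt e₁ e₂ => e₁.eval s < e₂.eval s
  | .realLe e₁ e₂ => e₁.eval s ≤ e₂.eval s
  | .neg b => ¬ b.Holds s
  | .conj b₁ b₂ => b₁.Holds s ∧ b₂.Holds s

def BExp.cost : BExp → ℕ
  | .natEq e₁ e₂ => e₁.cost + e₂.cost + 1
  | .natLt e₁ e₂ => e₁.cost + e₂.cost + 1
  | .realLt e₁ e₂ => e₁.cost + e₂.cost + 1
  | .realLe e₁ e₂ => e₁.cost + e₂.cost + 1
  | .neg b => b.cost + 1
  | .conj b₁ b₂ => b₁.cost + b₂.cost + 1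

def State.setNat (s : State) (x n : ℕ) : State :=
  { s with natVar := Function.update s.natVar x n }

noncomputable def State.setReal (s : State) (x : ℕ) (r : ℝ) : State :=
  { s with realVar := Function.update s.realVar x r }

def State.putNat (s : State) (A i j n : ℕ) : State :=
  { s with natArr := fun B k l => if B = A ∧ k = i ∧ l = j then n else s.natArr B k l }

noncomputable def State.putReal (s : State) (A i j : ℕ) (r : ℝ) : State :=
  { s with realArr := fun B k l => if B = A ∧ k = i ∧ l = j then r else s.realArr B k l }

/-- `Exec p s s' t`: the program `p`, started in the state `s`, halts in the state `s'` after exactly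
`t` time units. -/
inductive Exec : Prog → State → State → ℕ → Prop where
  | nop (s : State) : Exec .nop s s 1
  | setNat (s : State) (x : ℕ) (e : NExp) :
      Exec (.setNat x e) s (s.setNat x (e.eval s)) (e.cost + 1)
  | setReal (s : State) (x : ℕ) (e : RExp) :
      Exec (.setReal x e) s (s.setReal x (e.eval s)) (e.cost + 1)
  | putNat (s : State) (A : ℕ) (e₁ e₂ e : NExp) :
      Exec (.putNat A e₁ e₂ e) s (s.putNat A (e₁.eval s) (e₂.eval s) (e.eval s))
        (e₁.cost + e₂.cost + e.cost + 1)
  | putReal (s : State) (A : ℕ) (e₁ e₂ : NExp) (e : RExp) :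
      Exec (.putReal A e₁ e₂ e) s (s.putReal A (e₁.eval s) (e₂.eval s) (e.eval s))
        (e₁.cost + e₂.cost + e.cost + 1)
  | seq {p q : Prog} {s₁ s₂ s₃ : State} {t₁ t₂ : ℕ} :
      Exec p s₁ s₂ t₁ → Exec q s₂ s₃ t₂ → Exec (.seq p q) s₁ s₃ (t₁ + t₂)
  | branch_true {b : BExp} {p q : Prog} {s s' : State} {t : ℕ} :
      b.Holds s → Exec p s s' t → Exec (.branch b p q) s s' (b.cost + 1 + t)
  | branch_false {b : BExp} {p q : Prog} {s s' : State} {t : ℕ} :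
      ¬ b.Holds s → Exec q s s' t → Exec (.branch b p q) s s' (b.cost + 1 + t)
  | loop_true {b : BExp} {p : Prog} {s₁ s₂ s₃ : State} {t₁ t₂ : ℕ} :
      b.Holds s₁ → Exec p s₁ s₂ t₁ → Exec (.loop b p) s₂ s₃ t₂ →
        Exec (.loop b p) s₁ s₃ (b.cost + 1 + t₁ + t₂)
  | loop_false {b : BExp} {p : Prog} {s : State} :
      ¬ b.Holds s → Exec (.loop b p) s s (b.cost + 1)

/-- The machine is deterministic: final state and running time are determined by program and input. -/
theorem Exec.deterministic {p : Prog} {s s₁ s₂ : State} {t₁ t₂ : ℕ}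
    (h₁ : Exec p s s₁ t₁) (h₂ : Exec p s s₂ t₂) : s₁ = s₂ ∧ t₁ = t₂ := by
  induction h₁ generalizing s₂ t₂ with
  | nop s => cases h₂; exact ⟨rfl, rfl⟩
  | setNat s x e => cases h₂; exact ⟨rfl, rfl⟩
  | setReal s x e => cases h₂; exact ⟨rfl, rfl⟩
  | putNat s A e₁ e₂ e => cases h₂; exact ⟨rfl, rfl⟩
  | putReal s A e₁ e₂ e => cases h₂; exact ⟨rfl, rfl⟩
  | seq _ _ ih₁ ih₂ =>
    cases h₂ with
    | seq k₁ k₂ =>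
      obtain ⟨rfl, rfl⟩ := ih₁ k₁
      obtain ⟨rfl, rfl⟩ := ih₂ k₂
      exact ⟨rfl, rfl⟩
  | branch_true hb _ ih =>
    cases h₂ with
    | branch_true _ k => obtain ⟨rfl, rfl⟩ := ih k; exact ⟨rfl, rfl⟩
    | branch_false hb' _ => exact absurd hb hb'
  | branch_false hb _ ih =>
    cases h₂ with
    | branch_true hb' _ => exact absurd hb' hb
    | branch_false _ k => obtain ⟨rfl, rfl⟩ := ih k; exact ⟨rfl, rfl⟩
  | loop_true hb _ _ ih₁ ih₂ =>
    cases h₂ with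
    | loop_true _ k₁ k₂ =>
      obtain ⟨rfl, rfl⟩ := ih₁ k₁
      obtain ⟨rfl, rfl⟩ := ih₂ k₂
      exact ⟨rfl, rfl⟩
    | loop_false hb' => exact absurd hb hb'
  | loop_false hb =>
    cases h₂ with
    | loop_true hb' _ _ => exact absurd hb' hb
    | loop_false _ => exact ⟨rfl, rfl⟩

/-- The extended real number that a pair of a natural tag and a real value stands for:
tag `0` means the value itself, tag `1` means `+∞`, any other tag means `-∞`. -/
noncomputable def decodeEReal (tag : ℕ) (x : ℝ) : EReal :=
  if tag = 0 then (x : EReal) else if tag = 1 then ⊤ else ⊥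

end RealRAM

/-! ## The auction that approximately maximizes the utility of the base station -/

namespace BSAuction

/-- An auction instance with `R` relay nodes and `D` destination nodes. -/
structure Instance (R D : ℕ) where
  /-- revenue of the base station per unit of data rate -/
  a : ℝ
  /-- threshold for the interference cost -/
  CT : ℝ
  /-- maximum transmission power of a relay -/
  Pm : ℝ
  /-- declared valuations -/
  α : Fin R → ℝ
  /-- power for processing the received information -/
  Pc : Fin R → ℝ
  /-- data rate achieved at `j` when relay `i` transmits to it at a given power -/
  rate : Fin R → Fin D → ℝ → ℝ
  /-- interference cost when relay `i` transmits to `j` at a given power -/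
  cost : Fin R → Fin D → ℝ → ℝ
  /-- the transmission powers `P*` chosen by the base station -/
  Pstar : Fin R → Fin D → ℝ
  Pstar_mem : ∀ i j, Pstar i j ∈ Set.Icc 0 Pm
  Pstar_max : ∀ i j, IsMaxOn (fun P => a * rate i j P - α i * (P + Pc i) - cost i j P)
    (Set.Icc 0 Pm) (Pstar i j)

/-- A set of relay-destination edges is a matching if no two of its edges share an endpoint. -/
def IsMatching {R D : ℕ} (m : Finset (Fin R × Fin D)) : Prop :=
  ∀ e ∈ m, ∀ f ∈ m, e ≠ f → e.1 ≠ f.1 ∧ e.2 ≠ f.2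

/-- `m` is a maximal matching of the bipartite graph with edge set `E`: it is a matching contained in
`E`, and adding any further edge of `E` destroys this property. -/
def IsMaximalMatching {R D : ℕ} (E m : Finset (Fin R × Fin D)) : Prop :=
  m ⊆ E ∧ IsMatching m ∧ ∀ e ∈ E, e ∉ m → ¬ IsMatching (insert e m)

open Classical in
/-- The finite set of all maximal matchings of the bipartite graph with edge set `E`. -/
noncomputable def maximalMatchings {R D : ℕ} (E : Finset (Fin R × Fin D)) :
    Finset (Finset (Fin R × Fin D)) :=
  E.powerset.filter (IsMaximalMatching E)

/-- Edges of the complete bipartite graph `G` between relays and destinations. -/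
def completeEdges (R D : ℕ) : Finset (Fin R × Fin D) := Finset.univ

/-- Edges of `G` with the relay node `i` deleted. -/
def edgesWithout {R : ℕ} (D : ℕ) (i : Fin R) : Finset (Fin R × Fin D) :=
  (completeEdges R D).filter (fun e => e.1 ≠ i)

/-- Edges of `G` (for `none`), or of `G` with one relay node deleted. -/
def edgesExcluding {R : ℕ} (D : ℕ) : Option (Fin R) → Finset (Fin R × Fin D)
  | none => completeEdges R D
  | some i => edgesWithout D i

/-- The relays that are matched by `m`. -/
def relaysOf {R D : ℕ} (m : Finset (Fin R × Fin D)) : Finset (Fin R) := m.image Prod.fst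

/-- The value of `f` at `k` if `k < n`, and `0` otherwise. -/
def pad {n : ℕ} (f : Fin n → ℝ) (k : ℕ) : ℝ :=
  if h : k < n then f ⟨k, h⟩ else 0

namespace Instance

variable {R D : ℕ} (I : Instance R D)

/-- `U*`, the largest contribution of the pair `(i, j)` to the utility of the base station. -/
noncomputable def Ustar (i : Fin R) (j : Fin D) : ℝ :=
  I.a * I.rate i j (I.Pstar i j) - I.α i * (I.Pstar i j + I.Pc i) - I.cost i j (I.Pstar i j)

open Classical in
/-- The weight of an edge: `U*` if the interference cost is at most the threshold, else `-∞`. -/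
noncomputable def edgeWeight (e : Fin R × Fin D) : EReal :=
  if I.cost e.1 e.2 (I.Pstar e.1 e.2) ≤ I.CT then (I.Ustar e.1 e.2 : EReal) else ⊥

/-- The weight of a matching. -/
noncomputable def weight (m : Finset (Fin R × Fin D)) : EReal := ∑ e ∈ m, I.edgeWeight e

/-- Largest weight of a maximal matching of the graph with edge set `E`. -/
noncomputable def maxWeight (E : Finset (Fin R × Fin D)) : EReal :=
  (maximalMatchings E).sup I.weight

/-- `m` is a maximal matching of largest weight in the graph with edge set `E`. -/
def IsOptimal (E m : Finset (Fin R × Fin D)) : Prop :=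
  m ∈ maximalMatchings E ∧ ∀ m' ∈ maximalMatchings E, I.weight m' ≤ I.weight m

/-- `w_max`. -/
noncomputable def wMax : EReal := I.maxWeight (completeEdges R D)

/-- `w_max^{-i}`: largest weight of a maximal matching of `G` that does not match relay `i`. -/
noncomputable def wMaxWithout (i : Fin R) : EReal :=
  ((maximalMatchings (completeEdges R D)).filter (fun m => i ∉ relaysOf m)).sup I.weight

/-- The result of the auction: allocation `m`, payments and transmission powers of the relays.
If `w_max = -∞` (every maximal matching uses a forbidden edge), then the payment formula reads
`-∞ - (-∞) + …`, which has no value, and the payments to the winners are left unspecified. -/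
structure IsOutcome (m : Finset (Fin R × Fin D)) (pay : Fin R → EReal) (power : Fin R → ℝ) :
    Prop where
  optimal : I.IsOptimal (completeEdges R D) m
  pay_winner : I.wMax ≠ ⊥ → ∀ i j, (i, j) ∈ m →
    pay i = I.wMax - I.wMaxWithout i + ((I.α i * (I.Pstar i j + I.Pc i) : ℝ) : EReal)
  pay_loser : ∀ i, i ∉ relaysOf m → pay i = 0
  power_winner : ∀ i j, (i, j) ∈ m → power i = I.Pstar i j
  power_loser : ∀ i, i ∉ relaysOf m → power i = 0

/-- The initial memory: it holds the numbers `R`, `D`, the index of a relay to be excluded (or `R` if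
none is), the constants `a` and `C_T`, the declared valuations, the processing powers, the transmission
powers `P*`, and the data rates and interference costs at these powers.  All other cells hold `0`. -/
noncomputable def load (excl : Option (Fin R)) : RealRAM.State where
  natVar x :=
    match x with
    | 0 => R
    | 1 => D
    | 2 => match excl with
      | none => R
      | some i => (i : ℕ)
    | _ => 0
  realVar x :=
    match x with
    | 0 => I.a
    | 1 => I.CT
    | _ => 0
  natArr _ _ _ := 0
  realArr A k l :=
    match A with
    | 0 => if l = 0 then pad I.α k else 0
    | 1 => if l = 0 then pad I.Pc k else 0
    | 2 => pad (fun i => pad (fun j => I.Pstar i j) l) k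
    | 3 => pad (fun i => pad (fun j => I.rate i j (I.Pstar i j)) l) k
    | 4 => pad (fun i => pad (fun j => I.cost i j (I.Pstar i j)) l) k
    | _ => 0

end Instance

/-! Where the results are found in the final memory. -/

/-- Relay `i` is matched to destination `j` if the cell `(i, 0)` of natural array `0` holds `j + 1`. -/
def outMatching (R D : ℕ) (s : RealRAM.State) : Finset (Fin R × Fin D) :=
  Finset.univ.filter (fun e => s.natArr 0 e.1 0 = (e.2 : ℕ) + 1)

/-- The payment of relay `i`: tag in natural array `1`, value in real array `5`. -/
noncomputable def outPay (R : ℕ) (s : RealRAM.State) (i : Fin R) : EReal :=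
  RealRAM.decodeEReal (s.natArr 1 i 0) (s.realArr 5 i 0)

/-- The transmission power of relay `i`: real array `6`. -/
noncomputable def outPower (R : ℕ) (s : RealRAM.State) (i : Fin R) : ℝ := s.realArr 6 i 0

/-- The weight of a matching: tag in natural variable `3`, value in real variable `2`. -/
noncomputable def outWeight (s : RealRAM.State) : EReal :=
  RealRAM.decodeEReal (s.natVar 3) (s.realVar 2)

/-- The time bound `𝓗` of the Hungarian algorithm on `R` relay nodes and `D` destination nodes. -/
noncomputable def hungarianTime (R D : ℕ) : ℝ :=
  ((R : ℝ) + D) ^ 2 * Real.log ((R : ℝ) + D) + ((R : ℝ) + D) * R * D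

end BSAuction

/-! Since `D < R`, at least `D` relays remain even after one is deleted. Hence a maximal matching of
`G` or `G^{-i}` leaves no destination free: it is the graph of an injective map from destinations to
relays avoiding the deleted relay (`exists_assignment_of_mem`, `IsAssignment.mem_maximalMatchings`).
The maximal matchings of `G^{-i}` are therefore exactly those of `G` that miss `i`, which is the
third claim, and the other claims reduce to a rectangular assignment problem.

Its rows are the destinations, its columns the relays, and its costs are `-U*`. A forbidden edge
gets the finite cost `big = 1 + ∑ (U*² + 1)`. As `|U| ≤ (U² + 1) / 2`, an assignment without
forbidden edges costs at most `(big - 1) / 2`, while one with a forbidden edge costs at least `(big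
+ 1) / 2`. So a cheapest assignment has largest weight, including the case where every weight is
`-∞` (`sum_edgeWeight_le_of_sum_bigCost_le`).

The assignment problem is solved by the Hungarian method with potentials `u`, `v`. The rectangular
shape is handled by keeping `v ≤ 0` and `v = 0` on unmatched columns; together with feasibility and
tightness this certifies optimality (`Dual.optimal`). Rows are inserted one at a time. An
alternating tree grows from the new row (`Tree.update`, `Tree.relax`) until a free tight column
appears, and the path to it is then flipped (`Augment.step`, `Augment.finish`). Maintaining the
least slack of each column makes a round cost `O(R)`. A phase has at most `D` rounds and there are
`D` phases, so a matching costs `O(D²R)`, which the summand `(R+D)RD` of the time bound already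
dominates.

The auction makes one matching computation for `w_max` and one for each of the `D` winners, whence
the extra factor `D`. The programs are verified in a small Hoare logic (`Runs`) with time bounds, a
syntactic frame rule (`Runs.frame`) and rules for loops. -/

namespace RealRAM

/-! ### A program logic with time bounds -/

/-- `p`, started in `s`, halts within `T` time units in a state that satisfies `Q`. -/
def Runs (p : Prog) (s : State) (T : ℕ) (Q : State → Prop) : Prop :=
  ∃ s' t, Exec p s s' t ∧ t ≤ T ∧ Q s'

theorem Runs.mono {p : Prog} {s : State} {T T' : ℕ} {Q Q' : State → Prop} (h : Runs p s T Q)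
    (hT : T ≤ T') (hQ : ∀ s', Q s' → Q' s') : Runs p s T' Q' := by
  obtain ⟨s', t, he, ht, hq⟩ := h
  exact ⟨s', t, he, ht.trans hT, hQ _ hq⟩

theorem Runs.seq {p q : Prog} {s : State} {T₁ T₂ : ℕ} {Q : State → Prop}
    (h : Runs p s T₁ fun s' => Runs q s' T₂ Q) : Runs (.seq p q) s (T₁ + T₂) Q := by
  obtain ⟨s₁, t₁, he₁, ht₁, s₂, t₂, he₂, ht₂, hq⟩ := h
  exact ⟨s₂, t₁ + t₂, .seq he₁ he₂, by omega, hq⟩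

/-! ### Write sets and the frame rule -/

/-- Names of the natural variables that a program may change. -/
def Prog.natVarWrites : Prog → List ℕ
  | .setNat x _ => [x]
  | .seq p q => p.natVarWrites ++ q.natVarWrites
  | .branch _ p q => p.natVarWrites ++ q.natVarWrites
  | .loop _ p => p.natVarWrites
  | _ => []

/-- Names of the real variables that a program may change. -/
def Prog.realVarWrites : Prog → List ℕ
  | .setReal x _ => [x]
  | .seq p q => p.realVarWrites ++ q.realVarWrites
  | .branch _ p q => p.realVarWrites ++ q.realVarWrites
  | .loop _ p => p.realVarWrites
  | _ => []

/-- Names of the natural arrays that a program may change. -/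
def Prog.natArrWrites : Prog → List ℕ
  | .putNat A _ _ _ => [A]
  | .seq p q => p.natArrWrites ++ q.natArrWrites
  | .branch _ p q => p.natArrWrites ++ q.natArrWrites
  | .loop _ p => p.natArrWrites
  | _ => []

/-- Names of the real arrays that a program may change. -/
def Prog.realArrWrites : Prog → List ℕ
  | .putReal A _ _ _ => [A]
  | .seq p q => p.realArrWrites ++ q.realArrWrites
  | .branch _ p q => p.realArrWrites ++ q.realArrWrites
  | .loop _ p => p.realArrWrites
  | _ => []

/-- `s` and `s'` agree on everything that `p` does not write to. -/
structure Agree (p : Prog) (s s' : State) : Prop where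
  natVar : ∀ x, x ∉ p.natVarWrites → s'.natVar x = s.natVar x
  realVar : ∀ x, x ∉ p.realVarWrites → s'.realVar x = s.realVar x
  natArr : ∀ A, A ∉ p.natArrWrites → s'.natArr A = s.natArr A
  realArr : ∀ A, A ∉ p.realArrWrites → s'.realArr A = s.realArr A

theorem Agree.refl (p : Prog) (s : State) : Agree p s s :=
  ⟨fun _ _ => rfl, fun _ _ => rfl, fun _ _ => rfl, fun _ _ => rfl⟩

theorem Agree.trans {p : Prog} {s₁ s₂ s₃ : State} (h : Agree p s₁ s₂) (h' : Agree p s₂ s₃) :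
    Agree p s₁ s₃ :=
  ⟨fun x hx => (h'.natVar x hx).trans (h.natVar x hx),
    fun x hx => (h'.realVar x hx).trans (h.realVar x hx),
    fun x hx => (h'.natArr x hx).trans (h.natArr x hx),
    fun x hx => (h'.realArr x hx).trans (h.realArr x hx)⟩

theorem Agree.weaken {p q : Prog} {s s' : State} (h : Agree p s s')
    (h₁ : p.natVarWrites ⊆ q.natVarWrites) (h₂ : p.realVarWrites ⊆ q.realVarWrites)
    (h₃ : p.natArrWrites ⊆ q.natArrWrites) (h₄ : p.realArrWrites ⊆ q.realArrWrites) :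
    Agree q s s' :=
  ⟨fun x hx => h.natVar x fun k => hx (h₁ k), fun x hx => h.realVar x fun k => hx (h₂ k),
    fun x hx => h.natArr x fun k => hx (h₃ k), fun x hx => h.realArr x fun k => hx (h₄ k)⟩

theorem Exec.agree {p : Prog} {s s' : State} {t : ℕ} (h : Exec p s s' t) : Agree p s s' := by
  induction h with
  | nop s => exact .refl _ _
  | setNat s x e =>
    refine ⟨fun y hy => ?_, fun _ _ => rfl, fun _ _ => rfl, fun _ _ => rfl⟩
    have : y ≠ x := by simpa [Prog.natVarWrites] using hy
    simp [State.setNat, this]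
  | setReal s x e =>
    refine ⟨fun _ _ => rfl, fun y hy => ?_, fun _ _ => rfl, fun _ _ => rfl⟩
    have : y ≠ x := by simpa [Prog.realVarWrites] using hy
    simp [State.setReal, this]
  | putNat s A e₁ e₂ e =>
    refine ⟨fun _ _ => rfl, fun _ _ => rfl, fun y hy => ?_, fun _ _ => rfl⟩
    have : y ≠ A := by simpa [Prog.natArrWrites] using hy
    simp [State.putNat, this]
  | putReal s A e₁ e₂ e =>
    refine ⟨fun _ _ => rfl, fun _ _ => rfl, fun _ _ => rfl, fun y hy => ?_⟩
    have : y ≠ A := by simpa [Prog.realArrWrites] using hy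
    simp [State.putReal, this]
  | seq _ _ ih₁ ih₂ =>
    refine (ih₁.weaken ?_ ?_ ?_ ?_).trans (ih₂.weaken ?_ ?_ ?_ ?_) <;>
      simp [Prog.natVarWrites, Prog.realVarWrites, Prog.natArrWrites, Prog.realArrWrites]
  | branch_true _ _ ih =>
    refine ih.weaken ?_ ?_ ?_ ?_ <;>
      simp [Prog.natVarWrites, Prog.realVarWrites, Prog.natArrWrites, Prog.realArrWrites]
  | branch_false _ _ ih =>
    refine ih.weaken ?_ ?_ ?_ ?_ <;>
      simp [Prog.natVarWrites, Prog.realVarWrites, Prog.natArrWrites, Prog.realArrWrites]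
  | loop_true _ _ _ ih₁ ih₂ =>
    refine (ih₁.weaken ?_ ?_ ?_ ?_).trans ih₂ <;>
      simp [Prog.natVarWrites, Prog.realVarWrites, Prog.natArrWrites, Prog.realArrWrites]
  | loop_false _ => exact .refl _ _

/-- Write sets are computable lists, so preservation of any named cell across a concrete program is
settled by `decide`. Postconditions below therefore list only what changes. -/
theorem Runs.frame {p : Prog} {s : State} {T : ℕ} {Q : State → Prop} (h : Runs p s T Q) :
    Runs p s T fun s' => Q s' ∧ Agree p s s' := by
  obtain ⟨s', t, he, ht, hq⟩ := h
  exact ⟨s', t, he, ht, hq, he.agree⟩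

/-! ### Weakest preconditions for loop-free code -/

/-- Weakest precondition of a loop-free program. -/
def Prog.wp : Prog → (State → Prop) → State → Prop
  | .nop, Q, s => Q s
  | .setNat x e, Q, s => Q (s.setNat x (e.eval s))
  | .setReal x e, Q, s => Q (s.setReal x (e.eval s))
  | .putNat A e₁ e₂ e, Q, s => Q (s.putNat A (e₁.eval s) (e₂.eval s) (e.eval s))
  | .putReal A e₁ e₂ e, Q, s => Q (s.putReal A (e₁.eval s) (e₂.eval s) (e.eval s))
  | .seq p q, Q, s => p.wp (q.wp Q) s
  | .branch b p q, Q, s => (b.Holds s → p.wp Q s) ∧ (¬ b.Holds s → q.wp Q s)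
  | .loop _ _, _, _ => False

/-- An upper bound for the running time of a loop-free program. -/
def Prog.maxTime : Prog → ℕ
  | .nop => 1
  | .setNat _ e => e.cost + 1
  | .setReal _ e => e.cost + 1
  | .putNat _ e₁ e₂ e => e₁.cost + e₂.cost + e.cost + 1
  | .putReal _ e₁ e₂ e => e₁.cost + e₂.cost + e.cost + 1
  | .seq p q => p.maxTime + q.maxTime
  | .branch b p q => b.cost + 1 + (p.maxTime + q.maxTime)
  | .loop _ _ => 0

theorem Runs.of_wp {p : Prog} {s : State} {Q : State → Prop} (h : p.wp Q s) :
    Runs p s p.maxTime Q := by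
  induction p generalizing s Q with
  | nop => exact ⟨_, _, .nop s, le_rfl, h⟩
  | setNat x e => exact ⟨_, _, .setNat s x e, le_rfl, h⟩
  | setReal x e => exact ⟨_, _, .setReal s x e, le_rfl, h⟩
  | putNat A e₁ e₂ e => exact ⟨_, _, .putNat s A e₁ e₂ e, le_rfl, h⟩
  | putReal A e₁ e₂ e => exact ⟨_, _, .putReal s A e₁ e₂ e, le_rfl, h⟩
  | seq p q ihp ihq => exact .seq ((ihp h).mono le_rfl fun _ h' => ihq h')
  | branch b p q ihp ihq =>
    by_cases hb : b.Holds s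
    · obtain ⟨s', t, he, ht, hq⟩ := ihp (h.1 hb)
      exact ⟨s', _, .branch_true hb he, by simp only [Prog.maxTime]; omega, hq⟩
    · obtain ⟨s', t, he, ht, hq⟩ := ihq (h.2 hb)
      exact ⟨s', _, .branch_false hb he, by simp only [Prog.maxTime]; omega, hq⟩
  -- The precondition of a loop is `False`, which is why the value `0` of `maxTime` on loops does no
  -- harm.
  | loop b p => exact h.elim

theorem Runs.of_wp_le {p : Prog} {s : State} {Q : State → Prop} {T : ℕ} (h : p.wp Q s)
    (hT : p.maxTime ≤ T) : Runs p s T Q :=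
  (Runs.of_wp h).mono hT fun _ => id

/-- Unlike the weakest precondition calculus, this rule allows loops inside the two branches. -/
theorem Runs.branch {b : BExp} {p q : Prog} {s : State} {Q : State → Prop} {T : ℕ}
    (h₁ : b.Holds s → Runs p s T Q) (h₂ : ¬ b.Holds s → Runs q s T Q) :
    Runs (.branch b p q) s (b.cost + 1 + T) Q := by
  by_cases hb : b.Holds s
  · obtain ⟨s', t, he, ht, hq⟩ := h₁ hb
    exact ⟨s', _, .branch_true hb he, by omega, hq⟩
  · obtain ⟨s', t, he, ht, hq⟩ := h₂ hb
    exact ⟨s', _, .branch_false hb he, by omega, hq⟩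

/-! ### Loops -/

/-- A loop whose invariant carries a bound `k` for the number of remaining iterations. -/
theorem Runs.loop {b : BExp} {p : Prog} {T : ℕ} (Inv : ℕ → State → Prop)
    (hstep : ∀ k s, Inv k s → b.Holds s → Runs p s T fun s' => ∃ k' < k, Inv k' s')
    {k : ℕ} {s : State} (h : Inv k s) :
    Runs (.loop b p) s (k * (T + b.cost + 1) + (b.cost + 1))
      fun s' => (∃ k', Inv k' s') ∧ ¬ b.Holds s' := by
  induction k using Nat.strong_induction_on generalizing s with
  | _ k ih =>
    by_cases hb : b.Holds s
    · obtain ⟨s₁, t₁, he₁, ht₁, k', hk', hi⟩ := hstep k s h hb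
      obtain ⟨s₂, t₂, he₂, ht₂, hq⟩ := ih k' hk' hi
      refine ⟨s₂, _, .loop_true hb he₁ he₂, ?_, hq⟩
      have : (k' + 1) * (T + b.cost + 1) ≤ k * (T + b.cost + 1) := Nat.mul_le_mul_right _ hk'
      have h2 : (k' + 1) * (T + b.cost + 1) = k' * (T + b.cost + 1) + (T + b.cost + 1) := by ring
      omega
    · exact ⟨s, _, .loop_false hb, by omega, ⟨k, h⟩, hb⟩

/-- `for x = 0, …, y - 1 do p` -/
def Prog.forVar (x y : ℕ) (p : Prog) : Prog :=
  .seq (.setNat x (.lit 0))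
    (.loop (.natLt (.var x) (.var y)) (.seq p (.setNat x (.add (.var x) (.lit 1)))))

/-- The body writes neither the counter nor the bound, so exactly `N` rounds are made. The invariant
is required after the increment of the counter, and each round may use that everything outside the
write set still has its value from before the loop. -/
theorem Runs.forVar {x y : ℕ} {p : Prog} {s : State} {T : ℕ} (N : ℕ) (Inv : ℕ → State → Prop)
    (hN : s.natVar y = N) (hx : x ∉ p.natVarWrites) (hy : y ∉ x :: p.natVarWrites)
    (h0 : Inv 0 (s.setNat x 0))
    (hstep : ∀ k s', k < N → s'.natVar x = k → Agree (Prog.forVar x y p) s s' → Inv k s' →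
      Runs p s' T fun s'' => Inv (k + 1) (s''.setNat x (k + 1))) :
    Runs (Prog.forVar x y p) s (N * (T + 8) + 6)
      fun s' => Inv N s' ∧ Agree (Prog.forVar x y p) s s' := by
  have hxy : y ≠ x := fun h => hy (by simp [h])
  have hyw : y ∉ (Prog.forVar x y p).natVarWrites := by
    simp only [List.mem_cons, not_or] at hy
    simp [Prog.forVar, Prog.natVarWrites, hy]
  -- The initial assignment costs 2, the increment 4, and each test 3 plus 1 for branching; the last
  -- test fails.
  have key : Runs (Prog.forVar x y p) s (2 + (N * (T + 4 + 3 + 1) + (3 + 1)))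
      fun s' => (∃ k, ∃ j, j + k = N ∧ s'.natVar x = j ∧ Agree (Prog.forVar x y p) s s' ∧ Inv j s') ∧
        ¬ BExp.Holds s' (.natLt (.var x) (.var y)) := by
    refine Runs.seq (Runs.of_wp_le ?_ (T := 2) (by simp [Prog.maxTime, NExp.cost]))
    refine Runs.loop
      (fun k s' => ∃ j, j + k = N ∧ s'.natVar x = j ∧ Agree (Prog.forVar x y p) s s' ∧ Inv j s')
      ?_ ⟨0, by simp, by simp [State.setNat, NExp.eval], ?_, h0⟩
    · rintro k s₁ ⟨j, hj, hxj, ha, hi⟩ hb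
      have hyN : s₁.natVar y = N := by rw [ha.natVar y hyw, hN]
      simp only [BExp.Holds, NExp.eval, hxj, hyN] at hb
      refine Runs.seq ((hstep j s₁ hb hxj ha hi).frame.mono le_rfl ?_)
      rintro s₂ ⟨hi', ha'⟩
      have hx2 : s₂.natVar x = j := by rw [ha'.natVar x hx, hxj]
      refine ⟨_, _, .setNat _ _ _, le_rfl, k - 1, by omega, j + 1, by omega, ?_, ?_, ?_⟩
      · simp [State.setNat, NExp.eval, hx2]
      · refine ha.trans ((ha'.weaken ?_ ?_ ?_ ?_).trans
          ((Exec.setNat s₂ x (.add (.var x) (.lit 1))).agree.weaken ?_ ?_ ?_ ?_)) <;>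
        simp [Prog.forVar, Prog.natVarWrites, Prog.realVarWrites, Prog.natArrWrites,
          Prog.realArrWrites]
      · simpa [NExp.eval, hx2] using hi'
    · refine (Exec.setNat s x (.lit 0)).agree.weaken ?_ ?_ ?_ ?_ <;>
        simp [Prog.forVar, Prog.natVarWrites, Prog.realVarWrites, Prog.natArrWrites,
          Prog.realArrWrites]
  refine key.mono (by ring_nf; omega) ?_
  rintro s' ⟨⟨k, j, hj, hxj, ha, hi⟩, hb⟩
  have hyN : s'.natVar y = N := by rw [ha.natVar y hyw, hN]
  simp only [BExp.Holds, NExp.eval, hxj, hyN, not_lt] at hb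
  obtain rfl : j = N := by omega
  exact ⟨hi, ha⟩

end RealRAM

namespace Hungarian

/-! ### The Hungarian method: invariants -/

/-- A matching `q` of the rows below `s` into the set `C` of columns, together with dual variables `u`
and `v` for the cost matrix `a` that satisfy complementary slackness. -/
structure Dual (a : ℕ → ℕ → ℝ) (C : Finset ℕ) (n s : ℕ) (u v : ℕ → ℝ) (q : ℕ → ℕ) : Prop where
  feas : ∀ r < n, ∀ c ∈ C, u r + v c ≤ a r c
  inj : ∀ r < s, ∀ r' < s, q r = q r' → r = r'
  mem : ∀ r < s, q r ∈ C
  tight : ∀ r < s, u r + v (q r) = a r (q r)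
  nonpos : ∀ c ∈ C, v c ≤ 0
  zero : ∀ c ∈ C, (∀ r < s, q r ≠ c) → v c = 0

variable {a : ℕ → ℕ → ℝ} {C : Finset ℕ} {n s : ℕ} {u v : ℕ → ℝ} {q : ℕ → ℕ}

/-- Linear programming duality: the cost of `q` is the sum of the `u r` plus the sum of `v` over all
of `C`, because `v` vanishes on unmatched columns. Any competitor omits only columns with `v ≤ 0`,
so its potentials sum to at least as much, and by feasibility its cost is no smaller than that sum.
-/
theorem Dual.optimal (h : Dual a C n n u v q) {σ : ℕ → ℕ} (hσ : ∀ r < n, σ r ∈ C)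
    (hinj : ∀ r < n, ∀ r' < n, σ r = σ r' → r = r') :
    ∑ r ∈ Finset.range n, a r (q r) ≤ ∑ r ∈ Finset.range n, a r (σ r) := by
  have image_sum : ∀ τ : ℕ → ℕ, (∀ r < n, ∀ r' < n, τ r = τ r' → r = r') →
      ∑ r ∈ Finset.range n, v (τ r) = ∑ c ∈ (Finset.range n).image τ, v c := by
    intro τ hτ
    rw [Finset.sum_image]
    intro r hr r' hr' e
    exact hτ r (by simpa using hr) r' (by simpa using hr') e
  have h1 : ∑ r ∈ Finset.range n, v (q r) = ∑ c ∈ C, v c := by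
    rw [image_sum q h.inj]
    refine Finset.sum_subset ?_ ?_
    · intro c hc
      obtain ⟨r, hr, rfl⟩ := Finset.mem_image.1 hc
      exact h.mem r (by simpa using hr)
    · intro c hc hc'
      refine h.zero c hc fun r hr e => hc' ?_
      exact Finset.mem_image.2 ⟨r, by simpa using hr, e⟩
  have h2 : ∑ c ∈ C, v c ≤ ∑ r ∈ Finset.range n, v (σ r) := by
    rw [image_sum σ hinj]
    have hsub : (Finset.range n).image σ ⊆ C := by
      intro c hc
      obtain ⟨r, hr, rfl⟩ := Finset.mem_image.1 hc
      exact hσ r (by simpa using hr)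
    rw [← Finset.sum_sdiff hsub]
    have : ∑ c ∈ C \ (Finset.range n).image σ, v c ≤ 0 :=
      Finset.sum_nonpos fun c hc => h.nonpos c (Finset.mem_sdiff.1 hc).1
    linarith
  calc ∑ r ∈ Finset.range n, a r (q r)
      = ∑ r ∈ Finset.range n, u r + ∑ r ∈ Finset.range n, v (q r) := by
        rw [← Finset.sum_add_distrib]
        exact Finset.sum_congr rfl fun r hr => (h.tight r (by simpa using hr)).symm
    _ ≤ ∑ r ∈ Finset.range n, u r + ∑ r ∈ Finset.range n, v (σ r) := by linarith
    _ ≤ ∑ r ∈ Finset.range n, a r (σ r) := by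
        rw [← Finset.sum_add_distrib]
        refine Finset.sum_le_sum fun r hr => ?_
        have hr' : r < n := by simpa using hr
        exact h.feas r hr' _ (hσ r hr')

/-- With no row matched, `v` has to vanish everywhere, so the constant `u` must lie below all costs.
The matching conditions are vacuous, whence `q` is arbitrary. -/
theorem Dual.init {M : ℝ} (hM : ∀ r < n, ∀ c ∈ C, -M ≤ a r c) (hu : ∀ r < n, u r = -M)
    (hv : ∀ c ∈ C, v c = 0) (q : ℕ → ℕ) : Dual a C n 0 u v q where
  feas r hr c hc := by rw [hu r hr, hv c hc]; linarith [hM r hr c hc]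
  inj := by simp
  mem := by simp
  tight := by simp
  nonpos c hc := (hv c hc).le
  zero c hc _ := hv c hc

/-! ### Growing the alternating tree -/

/-- The alternating tree grown from the row `s`: the rows in it have the positive stamps `ur` (at most
`k`), the columns in it (or outside `C`) have the marks `uc`, every other column has the least slack
`mv` to a row of the tree, and `w` points to the parent row. -/
structure Tree (a : ℕ → ℕ → ℝ) (C : Finset ℕ) (n s : ℕ) (u v : ℕ → ℝ) (q ur uc w : ℕ → ℕ)
    (mv : ℕ → ℝ) (k : ℕ) : Prop extends Dual a C n s u v q where
  root : ur s ≠ 0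
  row_le : ∀ r < n, ur r ≠ 0 → r ≤ s
  stamp_le : ∀ r < n, ur r ≤ k
  count : k + ((Finset.range s).filter (ur · = 0)).card = s + 1
  row_iff : ∀ r < s, ur r = 0 ↔ uc (q r) = 0
  matched : ∀ c ∈ C, uc c ≠ 0 → ∃ r < s, q r = c
  slack_le : ∀ c ∈ C, uc c = 0 → ∀ r < n, ur r ≠ 0 → mv c ≤ a r c - u r - v c
  slack_eq : ∀ c ∈ C, uc c = 0 → mv c = a (w c) c - u (w c) - v c
  parent_row : ∀ c ∈ C, ur (w c) ≠ 0
  parent_lt : ∀ c ∈ C, w c < n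
  parent_tight : ∀ r < s, ur r ≠ 0 → u (w (q r)) + v (q r) = a (w (q r)) (q r)
  parent_stamp : ∀ r < s, ur r ≠ 0 → ur (w (q r)) < ur r

variable {ur uc w : ℕ → ℕ} {mv : ℕ → ℝ} {k : ℕ}

theorem Tree.init (h : Dual a C n s u v q) (hs : s < n) (hr : ∀ r < n, ur r = if r = s then 1 else 0)
    (huc : ∀ c ∈ C, uc c = 0) (hw : ∀ c ∈ C, w c = s)
    (hmv : ∀ c ∈ C, mv c = a s c - u s - v c) : Tree a C n s u v q ur uc w mv 1 where
  toDual := h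
  root := by simp [hr s hs]
  row_le r hrn h0 := by
    by_contra hne
    rw [hr r hrn, if_neg (by omega)] at h0
    exact h0 rfl
  stamp_le r hrn := by rw [hr r hrn]; split_ifs <;> simp
  count := by
    rw [Finset.filter_true_of_mem, Finset.card_range, add_comm]
    intro r hrs
    have : r < s := by simpa using hrs
    rw [hr r (by omega), if_neg (by omega)]
  row_iff r hrs := by
    rw [hr r (by omega), if_neg (by omega), huc _ (h.mem r hrs)]
  matched c hc h0 := absurd (huc c hc) h0
  slack_le c hc _ r hrn h0 := by
    have : r = s := by
      by_contra hne
      rw [hr r hrn, if_neg hne] at h0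
      exact h0 rfl
    rw [this, hmv c hc]
  slack_eq c hc _ := by rw [hw c hc, hmv c hc]
  parent_row c hc := by rw [hw c hc, hr s hs]; simp
  parent_lt c hc := by rw [hw c hc]; exact hs
  parent_tight r hrs h0 := by
    rw [hr r (by omega), if_neg (by omega)] at h0; exact absurd rfl h0
  parent_stamp r hrs h0 := by
    rw [hr r (by omega), if_neg (by omega)] at h0; exact absurd rfl h0

/-- Marked columns of `C` are matched to rows below `s`, so there are at most `s < n ≤ |C|` of them.
-/
theorem Tree.exists_unmarked (h : Tree a C n s u v q ur uc w mv k) (hs : s < n) (hC : n ≤ C.card) :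
    ∃ c ∈ C, uc c = 0 := by
  by_contra! hcon
  have : C ⊆ (Finset.range s).image q := by
    intro c hc
    obtain ⟨r, hr, e⟩ := h.matched c hc (hcon c hc)
    exact Finset.mem_image.2 ⟨r, by simpa using hr, e⟩
  have h1 := Finset.card_le_card this
  have h2 : ((Finset.range s).image q).card ≤ s := by
    simpa using Finset.card_image_le (s := Finset.range s) (f := q)
  omega

/-- Every growth step uses up one of the `s` earlier rows; this bounds the number of rounds in a
phase. -/
theorem Tree.stamp_bound (h : Tree a C n s u v q ur uc w mv k) : k ≤ s + 1 := by
  have := h.count; omega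

/-- The dual update by the least slack `δ`. -/
theorem Tree.update (h : Tree a C n s u v q ur uc w mv k) (hs : s < n) {δ : ℝ} {j : ℕ} (hj : j ∈ C)
    (huj : uc j = 0) (hδ : δ = mv j) (hmin : ∀ c ∈ C, uc c = 0 → δ ≤ mv c) {u' v' mv' : ℕ → ℝ}
    (hu : ∀ r < n, u' r = if ur r = 0 then u r else u r + δ)
    (hv : ∀ c ∈ C, v' c = if uc c = 0 then v c else v c - δ)
    (hmv : ∀ c ∈ C, uc c = 0 → mv' c = mv c - δ) :
    Tree a C n s u' v' q ur uc w mv' k ∧ mv' j = 0 := by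
  have h0 : 0 ≤ δ := by
    have h1 := h.slack_eq j hj huj
    have h2 := h.feas _ (h.parent_lt j hj) j hj
    rw [hδ, h1]; linarith
  refine ⟨?_, by rw [hmv j hj huj, hδ, sub_self]⟩
  refine { root := h.root, row_le := h.row_le, stamp_le := h.stamp_le, count := h.count,
           row_iff := h.row_iff, matched := h.matched, parent_row := h.parent_row,
           parent_lt := h.parent_lt, parent_stamp := h.parent_stamp, inj := h.inj, mem := h.mem,
           feas := ?_, tight := ?_, nonpos := ?_, zero := ?_, slack_le := ?_, slack_eq := ?_,
           parent_tight := ?_ }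
  · intro r hr c hc
    have hf := h.feas r hr c hc
    rw [hu r hr, hv c hc]
    -- The constraint can tighten only for a tree row and an unmarked column, and there the slack is
    -- at least `δ`. If both are in the tree the changes cancel.
    split_ifs with h1 h2 h2
    · exact hf
    · linarith
    · have := h.slack_le c hc h2 r hr h1
      have := hmin c hc h2
      linarith
    · linarith
  · intro r hr
    have ht := h.tight r hr
    have hi := h.row_iff r hr
    rw [hu r (by omega), hv _ (h.mem r hr)]
    by_cases h1 : ur r = 0
    · rw [if_pos h1, if_pos (hi.1 h1), ht]
    · rw [if_neg h1, if_neg (fun h2 => h1 (hi.2 h2))]; linarith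
  · intro c hc
    have := h.nonpos c hc
    rw [hv c hc]
    split_ifs <;> linarith
  · intro c hc hun
    -- An unmatched column is never marked, hence its potential remains 0.
    have hz : uc c = 0 := by
      by_contra h2
      obtain ⟨r, hr, e⟩ := h.matched c hc h2
      exact hun r hr e
    rw [hv c hc, if_pos hz, h.zero c hc hun]
  · intro c hc h2 r hr h1
    have := h.slack_le c hc h2 r hr h1
    rw [hmv c hc h2, hu r hr, if_neg h1, hv c hc, if_pos h2]; linarith
  · intro c hc h2
    have := h.slack_eq c hc h2
    rw [hmv c hc h2, hu _ (h.parent_lt c hc), if_neg (h.parent_row c hc), hv c hc, if_pos h2]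
    linarith
  · intro r hr h1
    have hm := h.mem r hr
    have := h.parent_tight r hr h1
    rw [hu _ (h.parent_lt _ hm), if_neg (h.parent_row _ hm), hv _ hm,
      if_neg (fun h2 => h1 ((h.row_iff r hr).2 h2))]
    linarith

/-- Adding the column `j` and its row `r₀` to the tree. -/
theorem Tree.relax (h : Tree a C n s u v q ur uc w mv k) (hs : s < n) {j r₀ : ℕ} (hj : j ∈ C)
    (huj : uc j = 0) (hmj : mv j = 0) (hr₀ : r₀ < s) (hq : q r₀ = j) {ur' uc' w' : ℕ → ℕ}
    {mv' : ℕ → ℝ} (hur : ∀ r, ur' r = if r = r₀ then k + 1 else ur r)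
    (huc : ∀ c ∈ C, uc' c = if c = j then 1 else uc c)
    (hw : ∀ c ∈ C, w' c = if uc' c = 0 ∧ a r₀ c - u r₀ - v c < mv c then r₀ else w c)
    (hmv : ∀ c ∈ C, uc' c = 0 →
      mv' c = if a r₀ c - u r₀ - v c < mv c then a r₀ c - u r₀ - v c else mv c) :
    Tree a C n s u v q ur' uc' w' mv' (k + 1) := by
  -- The row matched to an unmarked column is not yet in the tree.
  have hur0 : ur r₀ = 0 := (h.row_iff r₀ hr₀).2 (by rw [hq]; exact huj)
  have hur0' : ur' r₀ = k + 1 := by rw [hur, if_pos rfl]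
  have hpos : ∀ r, ur r ≠ 0 → ur' r = ur r := by
    intro r hr
    rw [hur, if_neg]
    rintro rfl
    exact hr hur0
  have hsub : ∀ c ∈ C, uc' c = 0 → uc c = 0 ∧ c ≠ j := by
    intro c hc h0
    rw [huc c hc] at h0
    split_ifs at h0 with h1
    exact ⟨h0, h1⟩
  -- Parents of marked columns are frozen, so the tree edges chosen earlier survive.
  have hwold : ∀ c ∈ C, uc' c ≠ 0 → w' c = w c := by
    intro c hc h0
    rw [hw c hc, if_neg (fun h1 => h0 h1.1)]
  have hrow : ∀ r < s, ur' r ≠ 0 → r ≠ r₀ → ur r ≠ 0 := by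
    intro r hr h0 h1
    rwa [hur, if_neg h1] at h0
  have hiff : ∀ r < s, ur' r = 0 ↔ uc' (q r) = 0 := by
    intro r hr
    rw [huc _ (h.mem r hr), hur]
    by_cases h1 : r = r₀
    · subst h1; simp [hq]
    · rw [if_neg h1, if_neg, h.row_iff r hr]
      intro h2
      exact h1 (h.inj r hr r₀ hr₀ (h2.trans hq.symm))
  have hpt : ∀ r < s, ur' r ≠ 0 → w' (q r) = w (q r) := fun r hr h0 =>
    hwold _ (h.mem r hr) (fun h1 => h0 ((hiff r hr).2 h1))
  refine { toDual := h.toDual, root := ?_, row_le := ?_, stamp_le := ?_, count := ?_, row_iff := hiff,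
           matched := ?_, slack_le := ?_, slack_eq := ?_, parent_row := ?_, parent_lt := ?_,
           parent_tight := ?_, parent_stamp := ?_ }
  · rw [hpos s h.root]; exact h.root
  · intro r hr h0
    rw [hur] at h0
    split_ifs at h0 with h1
    · omega
    · exact h.row_le r hr h0
  · intro r hr
    rw [hur]
    have := h.stamp_le r hr
    split_ifs <;> omega
  · have hset : (Finset.range s).filter (ur · = 0)
        = insert r₀ ((Finset.range s).filter (ur' · = 0)) := by
      ext r
      simp only [Finset.mem_filter, Finset.mem_range, Finset.mem_insert, hur]
      by_cases h1 : r = r₀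
      · subst h1; simp [hr₀, hur0]
      · simp [h1]
    have := h.count
    rw [hset, Finset.card_insert_of_notMem (by simp [hur0'])] at this
    omega
  · intro c hc h0
    rw [huc c hc] at h0
    split_ifs at h0 with h1
    · exact ⟨r₀, hr₀, hq.trans h1.symm⟩
    · exact h.matched c hc h0
  · intro c hc h0 r hr h1
    rw [hmv c hc h0]
    rw [hur] at h1
    split_ifs at h1 with h2
    · subst h2
      split_ifs with h3
      · exact le_rfl
      · exact not_lt.1 h3
    · have := h.slack_le c hc (hsub c hc h0).1 r hr h1
      split_ifs with h3
      · exact h3.le.trans this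
      · exact this
  · intro c hc h0
    rw [hmv c hc h0, hw c hc]
    by_cases h1 : a r₀ c - u r₀ - v c < mv c
    · rw [if_pos h1, if_pos ⟨h0, h1⟩]
    · rw [if_neg h1, if_neg (fun h2 => h1 h2.2)]
      exact h.slack_eq c hc (hsub c hc h0).1
  · intro c hc
    rw [hw c hc]
    split_ifs
    · rw [hur0']; omega
    · rw [hpos _ (h.parent_row c hc)]; exact h.parent_row c hc
  · intro c hc
    rw [hw c hc]
    split_ifs
    · omega
    · exact h.parent_lt c hc
  · intro r hr h0
    rw [hpt r hr h0]
    by_cases h1 : r = r₀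
    · subst h1
      rw [hq]
      have := h.slack_eq j hj huj
      linarith
    · exact h.parent_tight r hr (hrow r hr h0 h1)
  · intro r hr h0
    rw [hpt r hr h0, hpos _ (h.parent_row _ (h.mem r hr))]
    -- The new row carries the stamp `k + 1`, above every old stamp and in particular above that of
    -- its parent.
    by_cases h1 : r = r₀
    · subst h1
      rw [hur0']
      have := h.stamp_le _ (h.parent_lt _ (h.mem r hr))
      omega
    · rw [hpos r (hrow r hr h0 h1)]
      exact h.parent_stamp r hr (hrow r hr h0 h1)

/-! ### Flipping the augmenting path -/

/-- The state of the augmentation: the column `j` is to be matched to its parent row, whose stamp is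
below `b`. -/
structure Augment (a : ℕ → ℕ → ℝ) (C : Finset ℕ) (n s : ℕ) (u v : ℕ → ℝ) (q ur w : ℕ → ℕ)
    (j b : ℕ) : Prop where
  feas : ∀ r < n, ∀ c ∈ C, u r + v c ≤ a r c
  inj : ∀ r < s, ∀ r' < s, q r = q r' → r = r'
  mem : ∀ r < s, q r ∈ C
  tight : ∀ r < s, u r + v (q r) = a r (q r)
  nonpos : ∀ c ∈ C, v c ≤ 0
  zero : ∀ c ∈ C, c ≠ j → (∀ r < s, q r ≠ c) → v c = 0
  hole_mem : j ∈ C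
  hole : ∀ r < s, q r ≠ j
  hole_tight : u (w j) + v j = a (w j) j
  hole_stamp : ur (w j) < b
  row_le : ∀ c ∈ C, w c ≤ s
  parent_row : ∀ c ∈ C, ur (w c) ≠ 0
  parent_tight : ∀ r < s, ur r ≠ 0 → ur r < b → u (w (q r)) + v (q r) = a (w (q r)) (q r)
  parent_stamp : ∀ r < s, ur r ≠ 0 → ur r < b → ur (w (q r)) < ur r

theorem Tree.augment (h : Tree a C n s u v q ur uc w mv k) {j : ℕ} (hj : j ∈ C) (huj : uc j = 0)
    (hmj : mv j = 0) (hun : ∀ r < s, q r ≠ j) : Augment a C n s u v q ur w j (k + 1) where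
  feas := h.feas
  inj := h.inj
  mem := h.mem
  tight := h.tight
  nonpos := h.nonpos
  zero c hc _ := h.zero c hc
  hole_mem := hj
  hole := hun
  hole_tight := by have := h.slack_eq j hj huj; linarith
  hole_stamp := by have := h.stamp_le _ (h.parent_lt j hj); omega
  row_le c hc := h.row_le _ (h.parent_lt c hc) (h.parent_row c hc)
  parent_row := h.parent_row
  parent_tight r hr h0 _ := h.parent_tight r hr h0
  parent_stamp r hr h0 _ := h.parent_stamp r hr h0

variable {j b : ℕ}

/-- The parent row takes the free column and releases its own, which becomes the new hole. Tree
edges are tight, so slackness persists. Stamps strictly decrease towards the root; rows whose stamp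
has been reached or passed may have been rematched, hence parent conditions are kept only below `b`.
-/
theorem Augment.step (h : Augment a C n s u v q ur w j b) (hr : w j ≠ s) :
    Augment a C n s u v (Function.update q (w j) j) ur w (q (w j)) (ur (w j)) := by
  have hlt : w j < s := lt_of_le_of_ne (h.row_le j h.hole_mem) hr
  have hp := h.parent_row j h.hole_mem
  have hup : ∀ r, Function.update q (w j) j r = if r = w j then j else q r := fun r => by
    simp [Function.update_apply]
  refine { feas := h.feas, nonpos := h.nonpos, row_le := h.row_le, parent_row := h.parent_row,
           hole_mem := h.mem _ hlt, hole_tight := h.parent_tight _ hlt hp h.hole_stamp,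
           hole_stamp := h.parent_stamp _ hlt hp h.hole_stamp, inj := ?_, mem := ?_, tight := ?_,
           zero := ?_, hole := ?_, parent_tight := ?_, parent_stamp := ?_ }
  · intro r hr r' hr' e
    rw [hup, hup] at e
    split_ifs at e with h1 h2 h2
    · rw [h1, h2]
    · exact absurd e.symm (h.hole r' hr')
    · exact absurd e (h.hole r hr)
    · exact h.inj r hr r' hr' e
  · intro r hr
    rw [hup]
    split_ifs
    · exact h.hole_mem
    · exact h.mem r hr
  · intro r hr
    rw [hup]
    split_ifs with h1
    · rw [h1]; exact h.hole_tight
    · exact h.tight r hr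
  · intro c hc hne hun
    -- The old hole is now matched; only the new hole is exempt from having potential 0.
    have hcj : c ≠ j := by
      rintro rfl
      exact hun _ hlt (by rw [hup, if_pos rfl])
    refine h.zero c hc hcj fun r hr e => ?_
    by_cases h1 : r = w j
    · rw [h1] at e; exact hne e.symm
    · exact hun r hr (by rw [hup, if_neg h1, e])
  · intro r hr e
    rw [hup] at e
    split_ifs at e with h1
    · exact h.hole _ hlt e.symm
    · exact h1 (h.inj r hr _ hlt e)
  · intro r hr h0 hb
    rw [hup, if_neg (by rintro rfl; exact lt_irrefl _ hb)]
    exact h.parent_tight r hr h0 (hb.trans h.hole_stamp)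
  · intro r hr h0 hb
    rw [hup, if_neg (by rintro rfl; exact lt_irrefl _ hb)]
    exact h.parent_stamp r hr h0 (hb.trans h.hole_stamp)

/-- The root is the row that had no column: once it takes the hole, the matching covers one more row
and no column is exempt from complementary slackness. -/
theorem Augment.finish (h : Augment a C n s u v q ur w j b) (hr : w j = s) :
    Dual a C n (s + 1) u v (Function.update q s j) := by
  have hup : ∀ r, Function.update q s j r = if r = s then j else q r := fun r => by
    simp [Function.update_apply]
  refine { feas := h.feas, nonpos := h.nonpos, inj := ?_, mem := ?_, tight := ?_, zero := ?_ }
  · intro r hr r' hr' e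
    rw [hup, hup] at e
    split_ifs at e with h1 h2 h2
    · rw [h1, h2]
    · exact absurd e.symm (h.hole r' (by omega))
    · exact absurd e (h.hole r (by omega))
    · exact h.inj r (by omega) r' (by omega) e
  · intro r hr
    rw [hup]
    split_ifs
    · exact h.hole_mem
    · exact h.mem r (by omega)
  · intro r hr'
    rw [hup]
    split_ifs with h1
    · rw [h1, ← hr]; exact h.hole_tight
    · exact h.tight r (by omega)
  · intro c hc hun
    have hcj : c ≠ j := by
      rintro rfl
      exact hun s (by omega) (by rw [hup, if_pos rfl])
    refine h.zero c hc hcj fun r hr e => ?_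
    exact hun r (by omega) (by rw [hup, if_neg (by omega), e])

end Hungarian

open RealRAM

namespace Hungarian

/-! ### The Hungarian method: programs -/

/-- The columns `c < R` other than `x`. -/
abbrev columns (R x : ℕ) : Finset ℕ := (Finset.range R).erase x

/-- The sizes and the cost matrix in memory. -/
structure Env (a : ℕ → ℕ → ℝ) (R D x : ℕ) (s : State) : Prop where
  rows : s.natVar 1 = D
  cols : s.natVar 0 = R
  excl : s.natVar 2 = x
  cost : s.realArr 10 = a

variable {a : ℕ → ℕ → ℝ} {R D x : ℕ}

theorem Env.agree {s s' : State} {p : Prog} (h : Env a R D x s) (ha : Agree p s s')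
    (h0 : 0 ∉ p.natVarWrites) (h1 : 1 ∉ p.natVarWrites) (h2 : 2 ∉ p.natVarWrites)
    (h3 : 10 ∉ p.realArrWrites) : Env a R D x s' :=
  ⟨by rw [ha.natVar 1 h1, h.rows], by rw [ha.natVar 0 h0, h.cols], by rw [ha.natVar 2 h2, h.excl],
    by rw [ha.realArr 10 h3, h.cost]⟩

/-- Real arrays 11, 12 and 13 hold `u`, `v` and the slacks; natural arrays 10, 11, 12 and 13 hold
the matching, the row stamps, the column marks and the parents. The natural variable 10 is the row
being inserted. -/
def DualAt (a : ℕ → ℕ → ℝ) (R D x i : ℕ) (s : State) : Prop :=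
  Dual a (columns R x) D i (fun r => s.realArr 11 r 0) (fun c => s.realArr 12 c 0)
    (fun r => s.natArr 10 r 0)

/-- The last conjunct permanently marks the excluded column, so scans over all `c < R` pass it by.
For `x = R` the marked cell lies outside the scanned range. -/
def TreeAt (a : ℕ → ℕ → ℝ) (R D x i k : ℕ) (s : State) : Prop :=
  Tree a (columns R x) D i (fun r => s.realArr 11 r 0) (fun c => s.realArr 12 c 0)
    (fun r => s.natArr 10 r 0) (fun r => s.natArr 11 r 0) (fun c => s.natArr 12 c 0)
    (fun c => s.natArr 13 c 0) (fun c => s.realArr 13 c 0) k ∧ s.natArr 12 x 0 ≠ 0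

/-! ### Program for a new tree -/

def rowInit : Prog := .forVar 11 1 (.putNat 11 (.var 11) (.lit 0) (.lit 0))

def colInit : Prog := .forVar 12 0
  (.seq (.putReal 13 (.var 12) (.lit 0)
    (.sub (.sub (.get 10 (.var 10) (.var 12)) (.get 11 (.var 10) (.lit 0))) (.get 12 (.var 12) (.lit 0))))
  (.seq (.putNat 13 (.var 12) (.lit 0) (.var 10)) (.putNat 12 (.var 12) (.lit 0) (.lit 0))))

def treeInit : Prog :=
  .seq rowInit <| .seq colInit <| .seq (.putNat 11 (.var 10) (.lit 0) (.lit 1)) <|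
    .seq (.putNat 12 (.var 2) (.lit 0) (.lit 1)) <| .seq (.setNat 14 (.lit 1)) (.setNat 17 (.lit 0))

theorem rowInit_runs {s : State} (he : Env a R D x s) :
    Runs rowInit s (D * 20 + 6) fun s' => (∀ r < D, s'.natArr 11 r 0 = 0) ∧ Agree rowInit s s' := by
  refine (Runs.forVar D (T := 4) (fun k s' => ∀ r < k, s'.natArr 11 r 0 = 0) he.rows (by decide)
    (by decide) (by simp) ?_).mono (by omega) fun s' h => h
  intro k s' hk hx ha hi
  refine Runs.of_wp_le ?_ (by decide)
  simp only [Prog.wp, NExp.eval, State.putNat, State.setNat, hx, true_and]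
  intro r hr
  by_cases h : r = k
  · simp [h]
  · simp [h, hi r (by omega)]

theorem colInit_runs {s : State} (he : Env a R D x s) {i : ℕ} (hi : s.natVar 10 = i) :
    Runs colInit s (R * 30 + 6) fun s' => (∀ c < R, s'.natArr 12 c 0 = 0 ∧ s'.natArr 13 c 0 = i ∧
      s'.realArr 13 c 0 = a i c - s.realArr 11 i 0 - s.realArr 12 c 0) ∧ Agree colInit s s' := by
  refine (Runs.forVar R (T := 22) (fun k s' => ∀ c < k, s'.natArr 12 c 0 = 0 ∧ s'.natArr 13 c 0 = i ∧
      s'.realArr 13 c 0 = a i c - s.realArr 11 i 0 - s.realArr 12 c 0) he.cols (by decide)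
    (by decide) (by simp) ?_).mono (by omega) fun s' h => h
  intro k s' hk hx ha hI
  refine Runs.of_wp_le ?_ (by decide)
  have he' := he.agree ha (by decide) (by decide) (by decide) (by decide)
  have h10 : s'.natVar 10 = i := by rw [ha.natVar 10 (by decide), hi]
  simp only [Prog.wp, NExp.eval, RExp.eval, State.putNat, State.putReal, State.setNat, hx, h10,
    he'.cost, ha.realArr 11 (by decide), ha.realArr 12 (by decide), true_and]
  intro c hc
  by_cases h : c = k
  · simp [h]
  · simp [h, hI c (by omega)]

theorem treeInit_runs {s : State} (he : Env a R D x s) {i : ℕ} (hi : s.natVar 10 = i) (hiD : i < D)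
    (hd : DualAt a R D x i s) :
    Runs treeInit s ((D * 20 + 6) + ((R * 30 + 6) + 12)) fun s' =>
      TreeAt a R D x i 1 s' ∧ s'.natVar 14 = 1 ∧ s'.natVar 17 = 0 := by
  refine Runs.seq ((rowInit_runs he).mono le_rfl ?_)
  rintro s₁ ⟨hr, ha⟩
  have he₁ := he.agree ha (by decide) (by decide) (by decide) (by decide)
  have h10 : s₁.natVar 10 = i := by rw [ha.natVar 10 (by decide), hi]
  refine Runs.seq ((colInit_runs he₁ h10).mono le_rfl ?_)
  rintro s₂ ⟨hc, ha₂⟩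
  have he₂ := he₁.agree ha₂ (by decide) (by decide) (by decide) (by decide)
  have h10 : s₂.natVar 10 = i := by rw [ha₂.natVar 10 (by decide), h10]
  refine Runs.of_wp_le ?_ (by decide)
  simp only [Prog.wp, NExp.eval, State.putNat, State.setNat, h10, he₂.excl, Function.update_apply,
    TreeAt]
  refine ⟨?_, by simp, by simp⟩
  have hd' : Dual a (columns R x) D i (fun r => s₂.realArr 11 r 0) (fun c => s₂.realArr 12 c 0)
      (fun r => s₂.natArr 10 r 0) := by
    rw [ha₂.realArr 11 (by decide), ha₂.realArr 12 (by decide), ha₂.natArr 10 (by decide),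
      ha.realArr 11 (by decide), ha.realArr 12 (by decide), ha.natArr 10 (by decide)]
    exact hd
  have hcol : ∀ c ∈ columns R x, c ≠ x ∧ c < R := by simp
  simp
  refine Tree.init hd' hiD ?_ ?_ ?_ ?_
  · intro r hr'
    simp [ha₂.natArr 11 (by decide), hr r hr']
  · intro c hc'
    simp [(hcol c hc').1, hc c (hcol c hc').2]
  · intro c hc'
    simp [hc c (hcol c hc').2]
  · intro c hc'
    simp only [hc c (hcol c hc').2, ha₂.realArr 11 (by decide), ha₂.realArr 12 (by decide)]

variable {i k : ℕ}

theorem mem_columns {c : ℕ} : c ∈ columns R x ↔ c ≠ x ∧ c < R := by simp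

/-! ### Programs for one round of the search -/

/-- The value `R` in natural variable 13 signals that no unmarked column has been met yet, so no
infinite initial minimum is needed. -/
def argmin : Prog :=
  .seq (.setNat 13 (.var 0)) <| .forVar 12 0 <|
    .branch (.natEq (.get 12 (.var 12) (.lit 0)) (.lit 0))
      (.branch (.natEq (.var 13) (.var 0))
        (.seq (.setNat 13 (.var 12)) (.setReal 11 (.get 13 (.var 12) (.lit 0))))
        (.branch (.realLt (.get 13 (.var 12) (.lit 0)) (.var 11))
          (.seq (.setNat 13 (.var 12)) (.setReal 11 (.get 13 (.var 12) (.lit 0)))) .nop)) .nop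

theorem argmin_runs {s : State} (he : Env a R D x s) (hex : ∃ c < R, s.natArr 12 c 0 = 0) :
    Runs argmin s (R * 50 + 8) fun s' => (s'.natVar 13 < R ∧ s.natArr 12 (s'.natVar 13) 0 = 0 ∧
      s'.realVar 11 = s.realArr 13 (s'.natVar 13) 0 ∧
      ∀ c < R, s.natArr 12 c 0 = 0 → s'.realVar 11 ≤ s.realArr 13 c 0) ∧ Agree argmin s s' := by
  refine Runs.frame ?_
  refine (Runs.seq (Runs.of_wp_le (T := 2) ?_ (by decide)) :
    Runs _ _ (2 + (R * (42 + 8) + 6)) _).mono (by omega) fun _ h => h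
  refine (Runs.forVar R (T := 42) (fun k s' =>
      (s'.natVar 13 = R ∧ ∀ c < k, s.natArr 12 c 0 ≠ 0) ∨
      (s'.natVar 13 < k ∧ s.natArr 12 (s'.natVar 13) 0 = 0 ∧
      s'.realVar 11 = s.realArr 13 (s'.natVar 13) 0 ∧
      ∀ c < k, s.natArr 12 c 0 = 0 → s'.realVar 11 ≤ s.realArr 13 c 0))
    (by simp [State.setNat, he.cols]) (by decide)
    (by decide) (by simp [State.setNat, NExp.eval, he.cols]) ?_).mono le_rfl ?_
  · intro k s' hk hx ha hI
    refine Runs.of_wp_le ?_ (by decide)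
    have h0 : s'.natVar 0 = R := by rw [ha.natVar 0 (by decide)]; simp [State.setNat, he.cols]
    have h12 : s'.natArr 12 = s.natArr 12 := ha.natArr 12 (by decide)
    have h13 : s'.realArr 13 = s.realArr 13 := ha.realArr 13 (by decide)
    simp only [Prog.wp, NExp.eval, RExp.eval, BExp.Holds, State.setReal, State.setNat, hx, h0, h12,
      h13, Function.update_apply]
    refine ⟨fun hu => ⟨fun hR => Or.inr ?_, fun hR => ⟨fun hlt => Or.inr ?_, fun hlt => ?_⟩⟩, fun hu => ?_⟩
    · refine ⟨by simp, by simpa using hu, by simp, ?_⟩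
      intro c hc hc0
      rcases hI with ⟨_, hI⟩ | ⟨hI, _⟩
      · obtain rfl : c = k := by
          by_contra hne
          exact hI c (by omega) hc0
        simp
      · omega
    · refine ⟨by simp, by simpa using hu, by simp, ?_⟩
      intro c hc hc0
      rcases hI with ⟨hI, _⟩ | ⟨_, _, _, hI⟩
      · exact absurd hI hR
      · by_cases hck : c = k
        · simp [hck]
        · simpa using hlt.le.trans (hI c (by omega) hc0)
    · rcases hI with ⟨hI, _⟩ | ⟨h1, h2, h3, hI⟩
      · exact absurd hI hR
      · refine Or.inr ⟨by simpa using h1.trans (Nat.lt_succ_self k), by simpa using h2,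
          by simpa using h3, ?_⟩
        intro c hc hc0
        by_cases hck : c = k
        · rw [hck]; exact not_lt.1 hlt
        · exact hI c (by omega) hc0
    · rcases hI with ⟨h1, hI⟩ | ⟨h1, h2, h3, hI⟩
      · refine Or.inl ⟨by simpa using h1, fun c hc => ?_⟩
        by_cases hck : c = k
        · rw [hck]; exact hu
        · exact hI c (by omega)
      · refine Or.inr ⟨by simpa using h1.trans (Nat.lt_succ_self k), by simpa using h2,
          by simpa using h3, ?_⟩
        intro c hc hc0
        by_cases hck : c = k
        · rw [hck] at hc0; exact absurd hc0 hu
        · exact hI c (by omega) hc0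
  · rintro s' ⟨⟨_, h⟩ | h, _⟩
    · obtain ⟨c, hc, hc0⟩ := hex
      exact absurd hc0 (h c hc)
    · exact h

/-- The natural variable 11 is the counter and the real variable 11 the least slack; the two name
spaces are separate. -/
def rowUpdate : Prog := .forVar 11 1 <|
  .branch (.natEq (.get 11 (.var 11) (.lit 0)) (.lit 0)) .nop
    (.putReal 11 (.var 11) (.lit 0) (.add (.get 11 (.var 11) (.lit 0)) (.var 11)))

theorem rowUpdate_runs {s : State} (he : Env a R D x s) :
    Runs rowUpdate s (D * 30 + 6) fun s' => (∀ r < D, s'.realArr 11 r 0 =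
      if s.natArr 11 r 0 = 0 then s.realArr 11 r 0 else s.realArr 11 r 0 + s.realVar 11) ∧
      Agree rowUpdate s s' := by
  refine (Runs.forVar D (T := 22) (fun k s' => (∀ r < k, s'.realArr 11 r 0 =
      if s.natArr 11 r 0 = 0 then s.realArr 11 r 0 else s.realArr 11 r 0 + s.realVar 11) ∧
      -- Cells not reached by the counter still hold the old values, which the update in place
      -- reads.
      ∀ r, k ≤ r → s'.realArr 11 r 0 = s.realArr 11 r 0) he.rows (by decide)
    (by decide) (by simp [State.setNat]) ?_).mono (by omega) fun s' h => ⟨h.1.1, h.2⟩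
  rintro k s' hk hx ha ⟨h1, h2⟩
  refine Runs.of_wp_le ?_ (by decide)
  simp only [Prog.wp, NExp.eval, RExp.eval, BExp.Holds, State.putReal, State.setNat, hx, true_and,
    ha.natArr 11 (by decide), ha.realVar 11 (by decide)]
  refine ⟨fun h => ⟨fun r hr => ?_, fun r hr => h2 r (by omega)⟩,
    fun h => ⟨fun r hr => ?_, fun r hr => ?_⟩⟩
  · by_cases hrk : r = k
    · simp [hrk, h, h2 k le_rfl]
    · exact h1 r (by omega)
  · by_cases hrk : r = k
    · simp [hrk, h, h2 k le_rfl]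
    · simp [hrk, h1 r (by omega)]
  · simp [show r ≠ k by omega, h2 r (by omega)]

def colUpdate : Prog := .forVar 12 0 <|
  .branch (.natEq (.get 12 (.var 12) (.lit 0)) (.lit 0))
    (.putReal 13 (.var 12) (.lit 0) (.sub (.get 13 (.var 12) (.lit 0)) (.var 11)))
    (.putReal 12 (.var 12) (.lit 0) (.sub (.get 12 (.var 12) (.lit 0)) (.var 11)))

theorem colUpdate_runs {s : State} (he : Env a R D x s) :
    Runs colUpdate s (R * 40 + 6) fun s' => (∀ c < R,
      (s'.realArr 12 c 0 =
        if s.natArr 12 c 0 = 0 then s.realArr 12 c 0 else s.realArr 12 c 0 - s.realVar 11) ∧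
      (s.natArr 12 c 0 = 0 → s'.realArr 13 c 0 = s.realArr 13 c 0 - s.realVar 11)) ∧
      Agree colUpdate s s' := by
  refine (Runs.forVar R (T := 32) (fun k s' => (∀ c < k,
      (s'.realArr 12 c 0 =
        if s.natArr 12 c 0 = 0 then s.realArr 12 c 0 else s.realArr 12 c 0 - s.realVar 11) ∧
      (s.natArr 12 c 0 = 0 → s'.realArr 13 c 0 = s.realArr 13 c 0 - s.realVar 11)) ∧
      ∀ c, k ≤ c → s'.realArr 12 c 0 = s.realArr 12 c 0 ∧ s'.realArr 13 c 0 = s.realArr 13 c 0)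
    he.cols (by decide)
    (by decide) (by simp [State.setNat]) ?_).mono (by omega) fun s' h => ⟨h.1.1, h.2⟩
  rintro k s' hk hx ha ⟨h1, h2⟩
  refine Runs.of_wp_le ?_ (by decide)
  simp only [Prog.wp, NExp.eval, RExp.eval, BExp.Holds, State.putReal, State.setNat, hx, true_and,
    ha.natArr 12 (by decide), ha.realVar 11 (by decide)]
  refine ⟨fun h => ⟨fun c hc => ?_, fun c hc => ?_⟩, fun h => ⟨fun c hc => ?_, fun c hc => ?_⟩⟩
  · by_cases hck : c = k
    · simp [hck, h, h2 k le_rfl]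
    · simpa [hck] using h1 c (by omega)
  · simpa [show c ≠ k by omega] using h2 c (by omega)
  · by_cases hck : c = k
    · simp [hck, h, h2 k le_rfl]
    · simpa [hck] using h1 c (by omega)
  · simpa [show c ≠ k by omega] using h2 c (by omega)

/-- The inverse of the matching is not stored; a scan of the earlier rows fits into the `O(R)`
budget of a round. The result `i`, the unmatched root, signals a free column. -/
def findRow : Prog := .seq (.setNat 15 (.var 10)) <| .forVar 11 10 <|
  .branch (.natEq (.get 10 (.var 11) (.lit 0)) (.var 13)) (.setNat 15 (.var 11)) .nop

theorem findRow_runs {s : State} (hi : s.natVar 10 = i) :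
    Runs findRow s (i * 20 + 8) fun s' =>
      ((s'.natVar 15 = i ∧ ∀ r < i, s.natArr 10 r 0 ≠ s.natVar 13) ∨
        (s'.natVar 15 < i ∧ s.natArr 10 (s'.natVar 15) 0 = s.natVar 13)) ∧ Agree findRow s s' := by
  refine Runs.frame ?_
  refine (Runs.seq (Runs.of_wp_le (T := 2) ?_ (by decide)) :
    Runs _ _ (2 + (i * (12 + 8) + 6)) _).mono (by omega) fun _ h => h
  refine (Runs.forVar i (T := 12) (fun k s' =>
      ((s'.natVar 15 = i ∧ ∀ r < k, s.natArr 10 r 0 ≠ s.natVar 13) ∨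
        (s'.natVar 15 < i ∧ s.natArr 10 (s'.natVar 15) 0 = s.natVar 13)))
    (by simp [State.setNat, hi]) (by decide)
    (by decide) (by simp [State.setNat, NExp.eval, hi]) ?_).mono le_rfl fun _ h => h.1
  intro k s' hk hx ha hI
  refine Runs.of_wp_le ?_ (by decide)
  have h13 : s'.natVar 13 = s.natVar 13 := by
    rw [ha.natVar 13 (by decide)]; simp [State.setNat]
  have h10 : s'.natArr 10 = s.natArr 10 := ha.natArr 10 (by decide)
  simp only [Prog.wp, NExp.eval, BExp.Holds, State.setNat, hx, h13, h10, Function.update_apply]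
  refine ⟨fun h => Or.inr (by simpa using ⟨hk, h⟩), fun h => ?_⟩
  rcases hI with ⟨h1, h2⟩ | h1
  · refine Or.inl ⟨by simpa using h1, fun r hr => ?_⟩
    by_cases hrk : r = k
    · rw [hrk]; exact h
    · exact h2 r (by omega)
  · exact Or.inr (by simpa using h1)

/-- Only the new row is compared with the stored minimum, since slacks to older tree rows are
already accounted for. This keeps a round linear in `R`. -/
def relaxCols : Prog := .forVar 12 0 <|
  .branch (.conj (.natEq (.get 12 (.var 12) (.lit 0)) (.lit 0))
      (.realLt (.sub (.sub (.get 10 (.var 15) (.var 12)) (.get 11 (.var 15) (.lit 0)))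
        (.get 12 (.var 12) (.lit 0))) (.get 13 (.var 12) (.lit 0))))
    (.seq (.putReal 13 (.var 12) (.lit 0) (.sub (.sub (.get 10 (.var 15) (.var 12))
      (.get 11 (.var 15) (.lit 0))) (.get 12 (.var 12) (.lit 0))))
      (.putNat 13 (.var 12) (.lit 0) (.var 15))) .nop

theorem relaxCols_runs {s : State} (he : Env a R D x s) {r₀ : ℕ} (hr₀ : s.natVar 15 = r₀) :
    Runs relaxCols s (R * 60 + 6) fun s' => (∀ c < R,
      (s'.natArr 13 c 0 = if s.natArr 12 c 0 = 0 ∧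
        a r₀ c - s.realArr 11 r₀ 0 - s.realArr 12 c 0 < s.realArr 13 c 0 then r₀
        else s.natArr 13 c 0) ∧
      (s.natArr 12 c 0 = 0 → s'.realArr 13 c 0 =
        if a r₀ c - s.realArr 11 r₀ 0 - s.realArr 12 c 0 < s.realArr 13 c 0
        then a r₀ c - s.realArr 11 r₀ 0 - s.realArr 12 c 0 else s.realArr 13 c 0)) ∧
      Agree relaxCols s s' := by
  refine (Runs.forVar R (T := 52) (fun k s' => (∀ c < k,
      (s'.natArr 13 c 0 = if s.natArr 12 c 0 = 0 ∧
        a r₀ c - s.realArr 11 r₀ 0 - s.realArr 12 c 0 < s.realArr 13 c 0 then r₀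
        else s.natArr 13 c 0) ∧
      (s.natArr 12 c 0 = 0 → s'.realArr 13 c 0 =
        if a r₀ c - s.realArr 11 r₀ 0 - s.realArr 12 c 0 < s.realArr 13 c 0
        then a r₀ c - s.realArr 11 r₀ 0 - s.realArr 12 c 0 else s.realArr 13 c 0)) ∧
      ∀ c, k ≤ c → s'.natArr 13 c 0 = s.natArr 13 c 0 ∧ s'.realArr 13 c 0 = s.realArr 13 c 0)
    he.cols (by decide)
    (by decide) (by simp [State.setNat]) ?_).mono (by omega) fun s' h => ⟨h.1.1, h.2⟩
  rintro k s' hk hx ha ⟨h1, h2⟩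
  refine Runs.of_wp_le ?_ (by decide)
  have he' := he.agree ha (by decide) (by decide) (by decide) (by decide)
  have h15 : s'.natVar 15 = r₀ := by rw [ha.natVar 15 (by decide), hr₀]
  simp only [Prog.wp, NExp.eval, RExp.eval, BExp.Holds, State.putReal, State.putNat, State.setNat, hx,
    true_and, h15, he'.cost, ha.natArr 12 (by decide), ha.realArr 11 (by decide),
    ha.realArr 12 (by decide), (h2 k le_rfl).2]
  refine ⟨fun h => ⟨fun c hc => ?_, fun c hc => ?_⟩, fun h => ⟨fun c hc => ?_, fun c hc => ?_⟩⟩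
  · by_cases hck : c = k
    · simp [hck, h]
    · simpa [hck] using h1 c (by omega)
  · simpa [show c ≠ k by omega] using h2 c (by omega)
  · by_cases hck : c = k
    · subst hck
      rw [if_neg h]
      refine ⟨(h2 c le_rfl).1, fun h0 => ?_⟩
      rw [if_neg (fun h' => h ⟨h0, h'⟩)]
      exact (h2 c le_rfl).2
    · exact h1 c (by omega)
  · exact h2 c (by omega)

/-- Finds the column of least slack and updates the dual variables. -/
def dualStep : Prog := .seq argmin <| .seq rowUpdate colUpdate

theorem dualStep_runs {s : State} (he : Env a R D x s) (hiD : i < D)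
    (hDC : D ≤ (columns R x).card) (ht : TreeAt a R D x i k s) :
    Runs dualStep s ((R * 50 + 8) + ((D * 30 + 6) + (R * 40 + 6))) fun s' =>
      TreeAt a R D x i k s' ∧ s'.natVar 13 ∈ columns R x ∧ s'.natArr 12 (s'.natVar 13) 0 = 0 ∧
        s'.realArr 13 (s'.natVar 13) 0 = 0 := by
  obtain ⟨ht, hux⟩ := ht
  have hcol : ∀ c ∈ columns R x, c ≠ x ∧ c < R := fun c hc => mem_columns.1 hc
  obtain ⟨c₀, hc₀, huc₀⟩ := ht.exists_unmarked hiD hDC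
  refine Runs.seq ((argmin_runs he ⟨c₀, (hcol _ hc₀).2, huc₀⟩).mono le_rfl ?_)
  rintro s₁ ⟨⟨hj, huj, hδ, hmin⟩, ha₁⟩
  have he₁ := he.agree ha₁ (by decide) (by decide) (by decide) (by decide)
  refine Runs.seq ((rowUpdate_runs he₁).mono le_rfl ?_)
  rintro s₂ ⟨hu, ha₂⟩
  have he₂ := he₁.agree ha₂ (by decide) (by decide) (by decide) (by decide)
  refine (colUpdate_runs he₂).mono le_rfl ?_
  rintro s₃ ⟨hv, ha₃⟩
  -- The excluded column is marked, so the minimum is not attained there.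
  have hjx : s₁.natVar 13 ∈ columns R x :=
    mem_columns.2 ⟨fun h => hux (by rw [← h]; exact huj), hj⟩
  simp only [TreeAt, ha₃.natVar 13 (by decide), ha₂.natVar 13 (by decide),
    ha₃.natArr 10 (by decide), ha₂.natArr 10 (by decide), ha₁.natArr 10 (by decide),
    ha₃.natArr 11 (by decide), ha₂.natArr 11 (by decide), ha₁.natArr 11 (by decide),
    ha₃.natArr 12 (by decide), ha₂.natArr 12 (by decide), ha₁.natArr 12 (by decide),
    ha₃.natArr 13 (by decide), ha₂.natArr 13 (by decide), ha₁.natArr 13 (by decide),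
    ha₃.realArr 11 (by decide)]
  simp only [ha₂.natArr 12 (by decide), ha₁.natArr 12 (by decide), ha₂.realArr 12 (by decide),
    ha₁.realArr 12 (by decide), ha₂.realArr 13 (by decide), ha₁.realArr 13 (by decide),
    ha₂.realVar 11 (by decide)] at hv
  simp only [ha₁.natArr 11 (by decide), ha₁.realArr 11 (by decide)] at hu
  have key := ht.update hiD hjx huj hδ (fun c hc => hmin c (hcol c hc).2) hu
    (fun c hc => (hv c (hcol c hc).2).1) (fun c hc => (hv c (hcol c hc).2).2)
  exact ⟨⟨key.1, hux⟩, hjx, huj, key.2⟩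

/-- Adds the column in variable `13` and its row in variable `15` to the tree. -/
def grow : Prog :=
  .seq (.setNat 14 (.add (.var 14) (.lit 1))) <| .seq (.putNat 11 (.var 15) (.lit 0) (.var 14)) <|
    .seq (.putNat 12 (.var 13) (.lit 0) (.lit 1)) relaxCols

theorem grow_runs {s : State} (he : Env a R D x s) (hiD : i < D) (ht : TreeAt a R D x i k s)
    (hk : s.natVar 14 = k) (hj : s.natVar 13 ∈ columns R x) (huj : s.natArr 12 (s.natVar 13) 0 = 0)
    (hmj : s.realArr 13 (s.natVar 13) 0 = 0) (hr₀ : s.natVar 15 < i)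
    (hq : s.natArr 10 (s.natVar 15) 0 = s.natVar 13) :
    Runs grow s (R * 60 + 20) fun s' => TreeAt a R D x i (k + 1) s' ∧ s'.natVar 14 = k + 1 := by
  obtain ⟨ht, hux⟩ := ht
  have hcol : ∀ c ∈ columns R x, c ≠ x ∧ c < R := fun c hc => mem_columns.1 hc
  -- The state after the three assignments: the incremented counter is itself the stamp of the new
  -- row.
  let s₁ := ((s.setNat 14 (k + 1)).putNat 11 (s.natVar 15) 0 (k + 1)).putNat 12 (s.natVar 13) 0 1
  have he₁ : Env a R D x s₁ := by
    constructor <;> simp [s₁, State.setNat, State.putNat, he.rows, he.cols, he.excl, he.cost]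
  have h15 : s₁.natVar 15 = s.natVar 15 := by simp [s₁, State.setNat, State.putNat]
  have h12 : ∀ c, s₁.natArr 12 c 0 = if c = s.natVar 13 then 1 else s.natArr 12 c 0 := by
    simp [s₁, State.setNat, State.putNat]
  have h11 : ∀ r, s₁.natArr 11 r 0 = if r = s.natVar 15 then k + 1 else s.natArr 11 r 0 := by
    simp [s₁, State.setNat, State.putNat]
  have hrest : s₁.natArr 10 = s.natArr 10 ∧ s₁.natArr 13 = s.natArr 13 ∧ s₁.realArr = s.realArr ∧
      s₁.natVar 14 = k + 1 := by
    simp [s₁, State.setNat, State.putNat]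
  have key := relaxCols_runs he₁ h15
  have : Runs grow s (4 + (4 + (4 + (R * 60 + 6)))) fun s' =>
      TreeAt a R D x i (k + 1) s' ∧ s'.natVar 14 = k + 1 := by
    refine Runs.seq (Runs.of_wp_le ?_ (by decide))
    refine Runs.seq (Runs.of_wp_le ?_ (by decide))
    refine Runs.seq (Runs.of_wp_le ?_ (by decide))
    simp only [NExp.eval, State.setNat, State.putNat, Function.update_self, hk]
    refine Runs.mono (s := s₁) key le_rfl ?_
    rintro s₂ ⟨hw, ha⟩
    refine ⟨⟨?_, ?_⟩, by rw [ha.natVar 14 (by decide), hrest.2.2.2]⟩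
    · rw [ha.realArr 11 (by decide), ha.realArr 12 (by decide), ha.natArr 10 (by decide),
        ha.natArr 11 (by decide), ha.natArr 12 (by decide), hrest.1, hrest.2.2.1]
      rw [hrest.2.1, hrest.2.2.1] at hw
      exact ht.relax hiD hj huj hmj hr₀ hq h11 (fun c _ => h12 c)
        (fun c hc => (hw c (hcol c hc).2).1) (fun c hc => (hw c (hcol c hc).2).2)
    · rw [ha.natArr 12 (by decide), h12]
      split_ifs
      · simp
      · exact hux
  exact this.mono (by omega) fun _ h => h

/-- The variable `13` holds an unmatched column that is tight to the tree. -/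
structure Found (a : ℕ → ℕ → ℝ) (R D x i : ℕ) (s : State) : Prop where
  tree : ∃ k, TreeAt a R D x i k s
  mem : s.natVar 13 ∈ columns R x
  unmarked : s.natArr 12 (s.natVar 13) 0 = 0
  tight : s.realArr 13 (s.natVar 13) 0 = 0
  unmatched : ∀ r < i, s.natArr 10 r 0 ≠ s.natVar 13

def searchBody : Prog := .seq dualStep <| .seq findRow <|
  .branch (.natLt (.var 15) (.var 10)) grow (.setNat 17 (.lit 1))

def search : Prog := .loop (.natEq (.var 17) (.lit 0)) searchBody

theorem searchBody_runs {s : State} (he : Env a R D x s) (hi : s.natVar 10 = i) (hiD : i < D)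
    (hDR : D ≤ R) (hDC : D ≤ (columns R x).card) (ht : TreeAt a R D x i k s) (hk : s.natVar 14 = k)
    (hf : s.natVar 17 = 0) :
    Runs searchBody s (R * 300) fun s' =>
      (s'.natVar 17 = 0 ∧ TreeAt a R D x i (k + 1) s' ∧ s'.natVar 14 = k + 1) ∨
      (s'.natVar 17 = 1 ∧ Found a R D x i s') := by
  refine Runs.mono (T := (R * 50 + 8) + ((D * 30 + 6) + (R * 40 + 6)) +
    ((i * 20 + 8) + (4 + (R * 60 + 20)))) ?_ (by omega) fun _ h => h
  refine Runs.seq ((dualStep_runs he hiD hDC ht).frame.mono le_rfl ?_)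
  rintro s₁ ⟨⟨ht₁, hj, huj, hmj⟩, ha₁⟩
  have he₁ := he.agree ha₁ (by decide) (by decide) (by decide) (by decide)
  have hi₁ : s₁.natVar 10 = i := by rw [ha₁.natVar 10 (by decide), hi]
  refine Runs.seq ((findRow_runs hi₁).mono le_rfl ?_)
  rintro s₂ ⟨hr, ha₂⟩
  have he₂ := he₁.agree ha₂ (by decide) (by decide) (by decide) (by decide)
  have hi₂ : s₂.natVar 10 = i := by rw [ha₂.natVar 10 (by decide), hi₁]
  have ht₂ : TreeAt a R D x i k s₂ := by
    unfold TreeAt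
    rw [ha₂.realArr 11 (by decide), ha₂.realArr 12 (by decide), ha₂.realArr 13 (by decide),
      ha₂.natArr 10 (by decide), ha₂.natArr 11 (by decide), ha₂.natArr 12 (by decide),
      ha₂.natArr 13 (by decide)]
    exact ht₁
  rw [← ha₂.natArr 12 (by decide), ← ha₂.natVar 13 (by decide)] at huj
  rw [← ha₂.realArr 13 (by decide), ← ha₂.natVar 13 (by decide)] at hmj
  rw [← ha₂.natVar 13 (by decide)] at hj
  rw [← ha₂.natArr 10 (by decide), ← ha₂.natVar 13 (by decide)] at hr
  have hk₂ : s₂.natVar 14 = k := by rw [ha₂.natVar 14 (by decide), ha₁.natVar 14 (by decide), hk]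
  have hf₂ : s₂.natVar 17 = 0 := by rw [ha₂.natVar 17 (by decide), ha₁.natVar 17 (by decide), hf]
  refine Runs.mono (Runs.branch (T := R * 60 + 20) ?_ ?_) (by simp [BExp.cost, NExp.cost])
    fun _ h => h
  · intro hb
    simp only [BExp.Holds, NExp.eval, hi₂] at hb
    have hq : s₂.natArr 10 (s₂.natVar 15) 0 = s₂.natVar 13 := by
      rcases hr with hr | hr
      · omega
      · exact hr.2
    refine (grow_runs he₂ hiD ht₂ hk₂ hj huj hmj hb hq).frame.mono le_rfl ?_
    rintro s₃ ⟨⟨ht₃, hk₃⟩, ha₃⟩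
    exact Or.inl ⟨by rw [ha₃.natVar 17 (by decide), hf₂], ht₃, hk₃⟩
  · intro hb
    simp only [BExp.Holds, NExp.eval, hi₂] at hb
    refine Runs.of_wp_le ?_ (by simp [Prog.maxTime, NExp.cost])
    refine Or.inr ⟨by simp [State.setNat, NExp.eval], ⟨k, ht₂⟩, ?_, ?_, ?_, ?_⟩ <;>
      simp only [State.setNat, NExp.eval, Function.update_apply] <;> norm_num
    · simpa using hj
    · exact huj
    · exact hmj
    · rcases hr with hr | hr
      · exact hr.2
      · omega

theorem search_runs {s : State} (he : Env a R D x s) (hi : s.natVar 10 = i) (hiD : i < D)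
    (hDR : D ≤ R) (hDC : D ≤ (columns R x).card) (ht : TreeAt a R D x i 1 s) (hk : s.natVar 14 = 1)
    (hf : s.natVar 17 = 0) :
    Runs search s ((i + 1) * (R * 300 + 3 + 1) + (3 + 1)) fun s' => Found a R D x i s' := by
  -- The measure is `f = i + 2 - k` while the flag is 0. Since `k ≤ i + 1`, it is still positive
  -- when the round that raises the flag begins.
  refine (Runs.loop (T := R * 300) (fun f s' => Env a R D x s' ∧ s'.natVar 10 = i ∧
    ((s'.natVar 17 = 0 ∧ ∃ k, TreeAt a R D x i k s' ∧ s'.natVar 14 = k ∧ f + k = i + 2) ∨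
      (s'.natVar 17 = 1 ∧ Found a R D x i s'))) ?_ (k := i + 1)
    ⟨he, hi, Or.inl ⟨hf, 1, ht, hk, rfl⟩⟩).mono le_rfl ?_
  · rintro f s₁ ⟨he₁, hi₁, hI⟩ hb
    simp only [BExp.Holds, NExp.eval] at hb
    rcases hI with ⟨hf₁, k, ht₁, hk₁, hfk⟩ | hI
    · have hb := ht₁.1.stamp_bound
      refine (searchBody_runs he₁ hi₁ hiD hDR hDC ht₁ hk₁ hf₁).frame.mono le_rfl ?_
      rintro s₂ ⟨hI, ha⟩
      have he₂ := he₁.agree ha (by decide) (by decide) (by decide) (by decide)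
      have hi₂ : s₂.natVar 10 = i := by rw [ha.natVar 10 (by decide), hi₁]
      refine ⟨f - 1, by omega, he₂, hi₂, ?_⟩
      rcases hI with ⟨h1, h2, h3⟩ | hI
      · exact Or.inl ⟨h1, k + 1, h2, h3, by omega⟩
      · exact Or.inr hI
    · omega
  · rintro s' ⟨⟨f, _, _, hI⟩, hb⟩
    simp only [BExp.Holds, NExp.eval] at hb
    rcases hI with hI | hI
    · exact absurd hI.1 hb
    · exact hI.2

/-! ### Program for the augmentation and the whole method -/

/-- Variable 13 is the hole and variable 15 its parent row; variable 16 saves the released column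
before its cell is overwritten. -/
def augmentLoop : Prog := .loop (.neg (.natEq (.var 15) (.var 10))) <|
  .seq (.setNat 16 (.get 10 (.var 15) (.lit 0))) <|
  .seq (.putNat 10 (.var 15) (.lit 0) (.var 13)) <|
  .seq (.setNat 13 (.var 16)) (.setNat 15 (.get 13 (.var 13) (.lit 0)))

def augment : Prog := .seq (.setNat 15 (.get 13 (.var 13) (.lit 0))) <|
  .seq augmentLoop (.putNat 10 (.var 10) (.lit 0) (.var 13))

def AugmentAt (a : ℕ → ℕ → ℝ) (R D x i b : ℕ) (s : State) : Prop :=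
  Augment a (columns R x) D i (fun r => s.realArr 11 r 0) (fun c => s.realArr 12 c 0)
    (fun r => s.natArr 10 r 0) (fun r => s.natArr 11 r 0) (fun c => s.natArr 13 c 0)
    (s.natVar 13) b ∧ s.natVar 10 = i ∧ s.natVar 15 = s.natArr 13 (s.natVar 13) 0

theorem augment_runs {s : State} (hi : s.natVar 10 = i) (hf : Found a R D x i s) :
    Runs augment s (i * 30 + 70) fun s' => DualAt a R D x (i + 1) s' := by
  obtain ⟨⟨k, ht, -⟩, hj, huj, hmj, hun⟩ := hf
  have hk := ht.stamp_bound
  have haug := ht.augment hj huj hmj hun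
  refine Runs.mono (T := 5 + ((k + 1) * (17 + 4 + 1) + (4 + 1) + 4)) ?_ (by omega) fun _ h => h
  refine Runs.seq (Runs.of_wp_le ?_ (by decide))
  refine Runs.seq ?_
  -- The stamp bound of the invariant also serves as the bound for the remaining iterations.
  refine (Runs.loop (T := 17) (fun b s' => AugmentAt a R D x i b s') ?_ (k := k + 1) ?_).mono
    le_rfl ?_
  · rintro b s₁ ⟨hA, hi₁, h15⟩ hb
    simp only [BExp.Holds, NExp.eval, hi₁, h15] at hb
    refine Runs.of_wp_le ?_ (by decide)
    have hstep := hA.step hb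
    refine ⟨_, hA.hole_stamp, ?_⟩
    simp only [AugmentAt, NExp.eval, State.setNat, State.putNat, Function.update_apply, h15]
    refine ⟨?_, by simpa using hi₁, by simp⟩
    convert hstep using 1
    · funext r
      simp [Function.update_apply]
    all_goals simp
  · simp only [AugmentAt, NExp.eval, State.setNat, Function.update_apply]
    exact ⟨by simpa using haug, by simpa using hi, by simp⟩
  · rintro s₁ ⟨⟨b, hA, hi₁, h15⟩, hb⟩
    simp only [BExp.Holds, NExp.eval, hi₁, h15, not_not] at hb
    refine Runs.of_wp_le ?_ (by decide)
    have hfin := hA.finish hb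
    simp only [Prog.wp, DualAt, NExp.eval, State.putNat, hi₁]
    convert hfin using 1
    funext r
    simp [Function.update_apply]

def phase : Prog := .seq treeInit <| .seq search augment

/-- At most `i + 1 ≤ D` search rounds, each linear in `R`, dominate the initialization and the
augmentation. -/
theorem phase_runs {s : State} (he : Env a R D x s) (hi : s.natVar 10 = i) (hiD : i < D)
    (hDR : D ≤ R) (hDC : D ≤ (columns R x).card) (hd : DualAt a R D x i s) :
    Runs phase s (D * (R * 1000)) fun s' => DualAt a R D x (i + 1) s' := by
  have hbound : ((D * 20 + 6) + ((R * 30 + 6) + 12)) +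
      (((i + 1) * (R * 300 + 3 + 1) + (3 + 1)) + (i * 30 + 70)) ≤ D * (R * 1000) := by
    nlinarith [Nat.mul_le_mul_right (R * 300 + 4) (show i + 1 ≤ D from hiD),
      Nat.mul_le_mul_left D (show 1 ≤ R by omega), Nat.mul_le_mul_right R (show 1 ≤ D by omega)]
  refine Runs.mono ?_ hbound fun _ h => h
  refine Runs.seq ((treeInit_runs he hi hiD hd).frame.mono le_rfl ?_)
  rintro s₁ ⟨⟨ht, hk, hf⟩, ha⟩
  have he₁ := he.agree ha (by decide) (by decide) (by decide) (by decide)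
  have hi₁ : s₁.natVar 10 = i := by rw [ha.natVar 10 (by decide), hi]
  refine Runs.seq ((search_runs he₁ hi₁ hiD hDR hDC ht hk hf).frame.mono le_rfl ?_)
  rintro s₂ ⟨hf₂, ha₂⟩
  have hi₂ : s₂.natVar 10 = i := by rw [ha₂.natVar 10 (by decide), hi₁]
  exact augment_runs hi₂ hf₂

/-- The initial dual variables; the bound for the costs is in the real variable `10`. -/
def dualInit : Prog :=
  .seq (.forVar 11 1 (.putReal 11 (.var 11) (.lit 0) (.sub (.lit 0) (.var 10))))
    (.forVar 12 0 (.putReal 12 (.var 12) (.lit 0) (.lit 0)))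

theorem dualInit_runs {s : State} (he : Env a R D x s) {M : ℝ} (hs : s.realVar 10 = M)
    (hM : ∀ r < D, ∀ c < R, -M ≤ a r c) :
    Runs dualInit s ((D * 20 + 6) + (R * 20 + 6)) fun s' => DualAt a R D x 0 s' := by
  refine Runs.seq ((Runs.forVar D (T := 12) (fun k s' => ∀ r < k, s'.realArr 11 r 0 = -M) he.rows
    (by decide) (by decide) (by simp) ?_).mono (by omega) ?_)
  · intro k s' hk hx ha hI
    refine Runs.of_wp_le ?_ (by decide)
    simp only [Prog.wp, NExp.eval, RExp.eval, State.putReal, State.setNat, hx, true_and,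
      ha.realVar 10 (by decide), hs]
    intro r hr
    by_cases h : r = k
    · simp [h]
    · simp [h, hI r (by omega)]
  rintro s₁ ⟨hu, ha₁⟩
  have he₁ := he.agree ha₁ (by decide) (by decide) (by decide) (by decide)
  refine (Runs.forVar R (T := 12) (fun k s' => ∀ c < k, s'.realArr 12 c 0 = 0) he₁.cols
    (by decide) (by decide) (by simp) ?_).mono (by omega) ?_
  · intro k s' hk hx ha hI
    refine Runs.of_wp_le ?_ (by decide)
    simp only [Prog.wp, NExp.eval, RExp.eval, State.putReal, State.setNat, hx, true_and]
    intro r hr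
    by_cases h : r = k
    · simp [h]
    · simp [h, hI r (by omega)]
  rintro s₂ ⟨hv, ha₂⟩
  have h11 : s₂.realArr 11 = s₁.realArr 11 := ha₂.realArr 11 (by decide)
  refine Dual.init (M := M) (fun r hr c hc => hM r hr c (mem_columns.1 hc).2) ?_
    (fun c hc => hv c (mem_columns.1 hc).2) _
  rw [h11]
  exact hu

/-- The Hungarian method: the row `r` is matched to the column in the cell `(r, 0)` of the natural
array `10`. -/
def hungarian : Prog := .seq dualInit <| .forVar 10 1 phase

theorem hungarian_runs {s : State} (he : Env a R D x s) (hDR : D ≤ R) (hD : 1 ≤ D)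
    (hDC : D ≤ (columns R x).card) {M : ℝ} (hs : s.realVar 10 = M)
    (hM : ∀ r < D, ∀ c < R, -M ≤ a r c) :
    Runs hungarian s (D * (D * (R * 2000))) fun s' => DualAt a R D x D s' := by
  have hbound : ((D * 20 + 6) + (R * 20 + 6)) + (D * (D * (R * 1000) + 8) + 6) ≤
      D * (D * (R * 2000)) := by
    have h1 : 1 * R ≤ D * R := Nat.mul_le_mul_right R hD
    have h2 : 1 * (D * R) ≤ D * (D * R) := Nat.mul_le_mul_right _ hD
    have e1 : D * (D * (R * 1000) + 8) = 1000 * (D * (D * R)) + 8 * D := by ring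
    have e2 : D * (D * (R * 2000)) = 2000 * (D * (D * R)) := by ring
    omega
  refine Runs.mono ?_ hbound fun _ h => h
  refine Runs.seq ((dualInit_runs he hs hM).frame.mono le_rfl ?_)
  rintro s₁ ⟨hd, ha₁⟩
  have he₁ := he.agree ha₁ (by decide) (by decide) (by decide) (by decide)
  refine (Runs.forVar D (T := D * (R * 1000)) (fun k s' => DualAt a R D x k s') he₁.rows
    (by decide) (by decide) hd ?_).mono le_rfl fun _ h => h.1
  intro k s' hk hx ha hI
  have he' := he₁.agree ha (by decide) (by decide) (by decide) (by decide)
  exact phase_runs he' hx hk hDR hDC hI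

end Hungarian

namespace BSAuction

/-! ### Maximal matchings and assignments -/

/-- The graph of an assignment of relays to destinations. -/
def graphOf {R D : ℕ} (σ : Fin D → Fin R) : Finset (Fin R × Fin D) :=
  Finset.univ.image fun j => (σ j, j)

/-- An assignment of different relays, none of them the excluded one, to the destinations. -/
def IsAssignment {R D : ℕ} (x : Option (Fin R)) (σ : Fin D → Fin R) : Prop :=
  Function.Injective σ ∧ ∀ j, some (σ j) ≠ x

variable {R D : ℕ} {x : Option (Fin R)} {σ : Fin D → Fin R}

theorem mem_graphOf {e : Fin R × Fin D} : e ∈ graphOf σ ↔ σ e.2 = e.1 := by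
  simp only [graphOf, Finset.mem_image, Finset.mem_univ, true_and]
  constructor
  · rintro ⟨j, rfl⟩; rfl
  · intro h; exact ⟨e.2, by rw [h]⟩

theorem mem_relaysOf_graphOf {i : Fin R} : i ∈ relaysOf (graphOf σ) ↔ ∃ j, σ j = i := by
  simp only [relaysOf, Finset.mem_image, mem_graphOf, Prod.exists, exists_and_right, exists_eq_right]

theorem mem_edgesExcluding {e : Fin R × Fin D} : e ∈ edgesExcluding D x ↔ some e.1 ≠ x := by
  cases x <;> simp [edgesExcluding, edgesWithout, completeEdges]

theorem mem_maximalMatchings {E m : Finset (Fin R × Fin D)} :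
    m ∈ maximalMatchings E ↔ IsMaximalMatching E m := by
  simp only [maximalMatchings, Finset.mem_filter, Finset.mem_powerset, and_iff_right_iff_imp]
  exact fun h => h.1

theorem IsAssignment.isMatching (h : IsAssignment x σ) : IsMatching (graphOf σ) := by
  intro e he f hf hne
  rw [mem_graphOf] at he hf
  constructor
  · intro h1
    exact hne (Prod.ext h1 (h.1 (by rw [he, hf, h1])))
  · intro h2
    exact hne (Prod.ext (by rw [← he, ← hf, h2]) h2)

/-- Every destination is already used, so any further edge collides with the edge at its
destination. -/
theorem IsAssignment.mem_maximalMatchings (h : IsAssignment x σ) :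
    graphOf σ ∈ maximalMatchings (edgesExcluding D x) := by
  refine BSAuction.mem_maximalMatchings.2 ⟨fun e he => ?_, h.isMatching, fun e _ hm hi => ?_⟩
  · rw [mem_graphOf] at he
    rw [mem_edgesExcluding, ← he]
    exact h.2 _
  · refine (hi e (Finset.mem_insert_self _ _) (σ e.2, e.2) (Finset.mem_insert_of_mem ?_) ?_).2 rfl
    · rw [mem_graphOf]
    · intro h1
      exact hm (mem_graphOf.2 (by rw [h1]))

/-- This is where `D < R` enters. If a destination were free, at most `D - 1` relays would be
matched; together with the excluded one these are fewer than `R`, so some relay is free as well and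
the matching could be extended. -/
theorem exists_assignment_of_mem (hDR : D < R) {m : Finset (Fin R × Fin D)}
    (hm : m ∈ maximalMatchings (edgesExcluding D x)) : ∃ σ, IsAssignment x σ ∧ m = graphOf σ := by
  obtain ⟨hsub, hmat, hmax⟩ := mem_maximalMatchings.1 hm
  have hcov : ∀ j, ∃ i, (i, j) ∈ m := by
    by_contra! hcon
    obtain ⟨j, hj⟩ := hcon
    -- A matching has as many relays as destinations, both projections being injective on it.
    have hc1 : (relaysOf m).card = (m.image Prod.snd).card := by
      rw [relaysOf, Finset.card_image_of_injOn, Finset.card_image_of_injOn]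
      · intro e he f hf h
        by_contra hne
        exact (hmat e he f hf hne).2 h
      · intro e he f hf h
        by_contra hne
        exact (hmat e he f hf hne).1 h
    have hc2 : (m.image Prod.snd).card < D := by
      have : m.image Prod.snd ⊆ Finset.univ.erase j := by
        intro k hk
        obtain ⟨e, he, rfl⟩ := Finset.mem_image.1 hk
        refine Finset.mem_erase.2 ⟨fun h => hj e.1 ?_, Finset.mem_univ _⟩
        rwa [← h]
      have h1 := Finset.card_le_card this
      rw [Finset.card_erase_of_mem (Finset.mem_univ _), Finset.card_univ, Fintype.card_fin] at h1
      have := j.pos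
      omega
    have hex : ∃ i, i ∉ relaysOf m ∧ some i ≠ x := by
      by_contra! hcon
      have : (Finset.univ : Finset (Fin R)) ⊆ relaysOf m ∪ x.toFinset := by
        intro i _
        by_cases hi : i ∈ relaysOf m
        · exact Finset.mem_union_left _ hi
        · exact Finset.mem_union_right _ (by simp [← hcon i hi])
      have h1 := Finset.card_le_card this
      have h2 := Finset.card_union_le (relaysOf m) x.toFinset
      have h3 : x.toFinset.card ≤ 1 := by cases x <;> simp
      rw [Finset.card_univ, Fintype.card_fin] at h1
      omega
    obtain ⟨i, hi, hix⟩ := hex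
    refine hmax (i, j) (mem_edgesExcluding.2 hix) (hj i) ?_
    have hnew : ∀ f ∈ m, (i, j).1 ≠ f.1 ∧ (i, j).2 ≠ f.2 := fun f hf =>
      ⟨fun h => hi (Finset.mem_image.2 ⟨f, hf, h.symm⟩), fun h => hj f.1 (by rw [show j = f.2 from h]; exact hf)⟩
    intro e he f hf hne
    rcases Finset.mem_insert.1 he with rfl | he <;> rcases Finset.mem_insert.1 hf with rfl | hf
    · exact absurd rfl hne
    · exact hnew f hf
    · exact ⟨(hnew e he).1.symm, (hnew e he).2.symm⟩
    · exact hmat e he f hf hne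
  choose σ hσ using hcov
  refine ⟨σ, ⟨fun j k hjk => ?_, fun j => ?_⟩, ?_⟩
  · by_contra hne
    refine (hmat _ (hσ j) _ (hσ k) fun h => hne (congrArg Prod.snd h)).1 hjk
  · exact mem_edgesExcluding.1 (hsub (hσ j))
  · ext e
    rw [mem_graphOf]
    constructor
    · intro he
      by_contra hne
      refine (hmat _ (hσ e.2) e he fun h => hne (congrArg Prod.fst h)).2 rfl
    · intro he
      have := hσ e.2
      rwa [he] at this

namespace Instance

variable (I : Instance R D)

theorem weight_graphOf : I.weight (graphOf σ) = ∑ j, I.edgeWeight (σ j, j) := by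
  rw [weight, graphOf, Finset.sum_image]
  intro j _ k _ h
  exact congrArg Prod.snd h

theorem IsOptimal.maxWeight_eq {I : Instance R D} {E m : Finset (Fin R × Fin D)}
    (h : I.IsOptimal E m) : I.maxWeight E = I.weight m :=
  le_antisymm (Finset.sup_le h.2) (Finset.le_sup h.1)

theorem isOptimal_graphOf (hDR : D < R) (h : IsAssignment x σ)
    (hopt : ∀ τ : Fin D → Fin R, IsAssignment x τ →
      ∑ j, I.edgeWeight (τ j, j) ≤ ∑ j, I.edgeWeight (σ j, j)) :
    I.IsOptimal (edgesExcluding D x) (graphOf σ) := by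
  refine ⟨h.mem_maximalMatchings, fun m hm => ?_⟩
  obtain ⟨τ, hτ, rfl⟩ := exists_assignment_of_mem hDR hm
  rw [weight_graphOf, weight_graphOf]
  exact hopt τ hτ

/-- Deleting the relay `i` leaves the maximal matchings that do not match `i`. -/
theorem wMaxWithout_eq (hDR : D < R) (i : Fin R) :
    I.wMaxWithout i = I.maxWeight (edgesWithout D i) := by
  rw [wMaxWithout, maxWeight]
  congr 1
  ext m
  rw [Finset.mem_filter]
  constructor
  · rintro ⟨hm, hi⟩
    -- Both families consist of the graphs of injective assignments avoiding `i`.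
    obtain ⟨σ, hσ, rfl⟩ := exists_assignment_of_mem (x := none) hDR hm
    refine IsAssignment.mem_maximalMatchings (x := some i) ⟨hσ.1, fun j hj => hi ?_⟩
    exact mem_relaysOf_graphOf.2 ⟨j, by simpa using hj⟩
  · intro hm
    obtain ⟨σ, hσ, rfl⟩ := exists_assignment_of_mem (x := some i) hDR hm
    refine ⟨IsAssignment.mem_maximalMatchings (x := none) ⟨hσ.1, by simp⟩, fun hi => ?_⟩
    obtain ⟨j, rfl⟩ := mem_relaysOf_graphOf.1 hi
    exact hσ.2 j rfl

/-! ### Replacing the weight `-∞` by a large finite cost -/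

/-- The edge `e` respects the threshold. -/
def Allowed (e : Fin R × Fin D) : Prop := I.cost e.1 e.2 (I.Pstar e.1 e.2) ≤ I.CT

/-- A number that exceeds the difference of the weights of any two matchings. -/
noncomputable def big : ℝ := 1 + ∑ i, ∑ j, (I.Ustar i j * I.Ustar i j + 1)

open Classical in
/-- The costs handed over to the Hungarian method. -/
noncomputable def bigCost (e : Fin R × Fin D) : ℝ :=
  if I.Allowed e then -I.Ustar e.1 e.2 else I.big

theorem sum_edgeWeight_of_allowed (h : ∀ j, I.Allowed (σ j, j)) :
    ∑ j, I.edgeWeight (σ j, j) = ((∑ j, I.Ustar (σ j) j : ℝ) : EReal) := by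
  have h1 : ∀ j, I.edgeWeight (σ j, j) = (I.Ustar (σ j) j : EReal) := fun j => if_pos (h j)
  simp only [h1]
  induction (Finset.univ : Finset (Fin D)) using Finset.induction_on with
  | empty => simp
  | insert j s hj ih => rw [Finset.sum_insert hj, Finset.sum_insert hj, ih, EReal.coe_add]

theorem sum_edgeWeight_of_not_allowed {j : Fin D} (h : ¬ I.Allowed (σ j, j)) :
    ∑ j, I.edgeWeight (σ j, j) = ⊥ := by
  rw [← Finset.add_sum_erase _ _ (Finset.mem_univ j),
    show I.edgeWeight (σ j, j) = ⊥ from if_neg h, EReal.bot_add]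

/-- For each destination the assignment picks one summand out of a sum of nonnegative terms over all
relays; injectivity plays no role. -/
theorem sum_square_le (σ : Fin D → Fin R) :
    ∑ j, (I.Ustar (σ j) j * I.Ustar (σ j) j + 1) ≤ I.big - 1 := by
  rw [big, add_sub_cancel_left, Finset.sum_comm]
  refine Finset.sum_le_sum fun j _ => ?_
  exact Finset.single_le_sum (f := fun i => I.Ustar i j * I.Ustar i j + 1)
    (fun i _ => add_nonneg (mul_self_nonneg _) zero_le_one) (Finset.mem_univ (σ j))

theorem one_le_big : 1 ≤ I.big := by
  have : 0 ≤ ∑ i, ∑ j, (I.Ustar i j * I.Ustar i j + 1) :=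
    Finset.sum_nonneg fun i _ => Finset.sum_nonneg fun j _ => add_nonneg (mul_self_nonneg _) zero_le_one
  rw [big]; linarith

/-- This supplies the lower bound on the costs from which the initial row potentials are taken. -/
theorem neg_big_le_bigCost (e : Fin R × Fin D) : -I.big ≤ I.bigCost e := by
  rw [bigCost]
  split_ifs
  · have h1 : I.Ustar e.1 e.2 * I.Ustar e.1 e.2 + 1 ≤ I.big - 1 := by
      rw [big, add_sub_cancel_left]
      refine (Finset.single_le_sum (f := fun j => I.Ustar e.1 j * I.Ustar e.1 j + 1)
        (fun i _ => add_nonneg (mul_self_nonneg _) zero_le_one) (Finset.mem_univ e.2)).trans ?_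
      exact Finset.single_le_sum (f := fun i => ∑ j, (I.Ustar i j * I.Ustar i j + 1))
        (fun i _ => Finset.sum_nonneg fun j _ => add_nonneg (mul_self_nonneg _) zero_le_one) (Finset.mem_univ e.1)
    nlinarith [sq_nonneg (I.Ustar e.1 e.2 - 1)]
  · linarith [I.one_le_big]

/-- If both assignments are allowed, costs are negated weights. If `τ` uses a forbidden edge, its
weight is `-∞`. If only `σ` does, its cost would exceed that of `τ`, against the hypothesis. -/
theorem sum_edgeWeight_le_of_sum_bigCost_le {τ : Fin D → Fin R}
    (h : ∑ j, I.bigCost (σ j, j) ≤ ∑ j, I.bigCost (τ j, j)) :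
    ∑ j, I.edgeWeight (τ j, j) ≤ ∑ j, I.edgeWeight (σ j, j) := by
  by_cases hτ : ∀ j, I.Allowed (τ j, j)
  swap
  · push Not at hτ
    obtain ⟨j, hj⟩ := hτ
    rw [I.sum_edgeWeight_of_not_allowed hj]
    exact bot_le
  have h2 : ∑ j, I.bigCost (τ j, j) = -∑ j, I.Ustar (τ j) j := by
    rw [← Finset.sum_neg_distrib]
    exact Finset.sum_congr rfl fun j _ => if_pos (hτ j)
  by_cases hσ : ∀ j, I.Allowed (σ j, j)
  · rw [I.sum_edgeWeight_of_allowed hσ, I.sum_edgeWeight_of_allowed hτ, EReal.coe_le_coe_iff]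
    have h1 : ∑ j, I.bigCost (σ j, j) = -∑ j, I.Ustar (σ j) j := by
      rw [← Finset.sum_neg_distrib]
      exact Finset.sum_congr rfl fun j _ => if_pos (hσ j)
    linarith
  · exfalso
    push Not at hσ
    obtain ⟨k, hk⟩ := hσ
    have hlow : I.big - (I.big - 1) / 2 ≤ ∑ j, I.bigCost (σ j, j) := by
      -- The single forbidden edge at `k` contributes `big`; all other terms are bounded below by
      -- `|U| ≤ (U² + 1) / 2`.
      have h3 : ∀ j, -((I.Ustar (σ j) j * I.Ustar (σ j) j + 1) / 2) +
          (if j = k then I.big else 0) ≤ I.bigCost (σ j, j) := by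
        intro j
        by_cases hjk : j = k
        · subst hjk
          rw [if_pos rfl, bigCost, if_neg hk]
          nlinarith [mul_self_nonneg (I.Ustar (σ j) j)]
        · rw [if_neg hjk, bigCost]
          have := I.one_le_big
          split_ifs <;> nlinarith [sq_nonneg (I.Ustar (σ j) j - 1), sq_nonneg (I.Ustar (σ j) j)]
      have h4 := Finset.sum_le_sum fun j (_ : j ∈ Finset.univ) => h3 j
      rw [Finset.sum_add_distrib, Finset.sum_neg_distrib, ← Finset.sum_div,
        Finset.sum_ite_eq' Finset.univ k, if_pos (Finset.mem_univ k)] at h4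
      have := I.sum_square_le σ
      linarith
    have hup : ∑ j, I.bigCost (τ j, j) ≤ (I.big - 1) / 2 := by
      have h3 : ∑ j, I.bigCost (τ j, j) ≤ ∑ j, (I.Ustar (τ j) j * I.Ustar (τ j) j + 1) / 2 := by
        refine Finset.sum_le_sum fun j _ => ?_
        rw [bigCost, if_pos (hτ j)]
        nlinarith [sq_nonneg (I.Ustar (τ j) j + 1)]
      rw [← Finset.sum_div] at h3
      have := I.sum_square_le τ
      linarith
    linarith [I.one_le_big]

end Instance

end BSAuction

namespace BSAuction

namespace Instance

/-! ### Programs for the auction -/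

variable {R D : ℕ} (I : Instance R D)

/-- The input is in memory, and `x` is the index of the excluded relay. -/
structure Loaded (x : ℕ) (s : State) : Prop where
  relays : s.natVar 0 = R
  dests : s.natVar 1 = D
  excl : s.natVar 2 = x
  revenue : s.realVar 0 = I.a
  threshold : s.realVar 1 = I.CT
  arrays : ∀ A < 5, s.realArr A = (I.load none).realArr A

variable {I} {x : ℕ}

theorem Loaded.agree {s s' : State} {p : Prog} (h : I.Loaded x s) (ha : Agree p s s')
    (h1 : ∀ y ∈ p.natVarWrites, 2 < y) (h2 : ∀ y ∈ p.realVarWrites, 1 < y)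
    (h3 : ∀ A ∈ p.realArrWrites, 4 < A) : I.Loaded x s' where
  relays := by rw [ha.natVar 0 fun k => absurd (h1 _ k) (by omega), h.relays]
  dests := by rw [ha.natVar 1 fun k => absurd (h1 _ k) (by omega), h.dests]
  excl := by rw [ha.natVar 2 fun k => absurd (h1 _ k) (by omega), h.excl]
  revenue := by rw [ha.realVar 0 fun k => absurd (h2 _ k) (by omega), h.revenue]
  threshold := by rw [ha.realVar 1 fun k => absurd (h2 _ k) (by omega), h.threshold]
  arrays A hA := by rw [ha.realArr A fun k => absurd (h3 _ k) (by omega), h.arrays A hA]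

/-- The expression `U*` for the relay `i` and the destination `j`. -/
def ustarExp (i j : NExp) : RExp :=
  .sub (.sub (.mul (.var 0) (.get 3 i j))
    (.mul (.get 0 i (.lit 0)) (.add (.get 2 i j) (.get 1 i (.lit 0))))) (.get 4 i j)

/-- The test for the interference cost. -/
def allowedExp (i j : NExp) : BExp := .realLe (.get 4 i j) (.var 1)

theorem ustarExp_eval {s : State} (h : I.Loaded x s) {e f : NExp} {i : Fin R} {j : Fin D}
    (he : e.eval s = i) (hf : f.eval s = j) : (ustarExp e f).eval s = I.Ustar i j := by
  simp [ustarExp, RExp.eval, NExp.eval, he, hf, h.revenue, h.arrays, load, pad, Ustar]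

theorem allowedExp_holds {s : State} (h : I.Loaded x s) {e f : NExp} {i : Fin R} {j : Fin D}
    (he : e.eval s = i) (hf : f.eval s = j) : (allowedExp e f).Holds s ↔ I.Allowed (i, j) := by
  simp [allowedExp, BExp.Holds, RExp.eval, he, hf, h.threshold, h.arrays, load, pad, Allowed]

/-! ### Computing the large constant and the cost matrix -/

def bigInner : Prog := .forVar 11 1 <|
  .seq (.setReal 12 (ustarExp (.var 12) (.var 11)))
    (.setReal 10 (.add (.var 10) (.add (.mul (.var 12) (.var 12)) (.lit 1))))

/-- Computes `big`. -/
def bigProg : Prog := .seq (.setReal 10 (.lit 1)) <| .forVar 12 0 bigInner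

theorem bigInner_runs {s : State} (h : I.Loaded x s) {i : Fin R} (hi : s.natVar 12 = i) :
    Runs bigInner s (D * 50 + 6) fun s' => s'.realVar 10 = s.realVar 10 +
      ∑ j, (I.Ustar i j * I.Ustar i j + 1) := by
  have h1 := Runs.forVar (x := 11) (y := 1) (p := (.seq (.setReal 12 (ustarExp (.var 12) (.var 11)))
    (.setReal 10 (.add (.var 10) (.add (.mul (.var 12) (.var 12)) (.lit 1)))))) (s := s) D (T := 42)
    (fun k s' => s'.realVar 10 = s.realVar 10 +
      ∑ j ∈ Finset.univ.filter (fun j : Fin D => (j : ℕ) < k), (I.Ustar i j * I.Ustar i j + 1)) h.dests (by decide)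
    (by decide) (by simp [State.setNat]) ?_
  · refine h1.mono (by omega) ?_
    rintro s' ⟨h2, -⟩
    simpa using h2
  intro k s' hk hx ha hI
  refine Runs.of_wp_le ?_ (by decide)
  have h' := h.agree ha (by decide) (by decide) (by decide)
  have hi' : s'.natVar 12 = i := by rw [ha.natVar 12 (by decide), hi]
  simp only [Prog.wp, ustarExp_eval (e := .var 12) (f := .var 11) (j := ⟨k, hk⟩) h' hi' hx]
  simp only [RExp.eval, State.setReal, State.setNat, Function.update_apply]
  simp only [hI]
  -- The partial sum over indices below `k + 1` gains exactly the term of index `k`.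
  rw [show (Finset.univ.filter fun j : Fin D => (j : ℕ) < k + 1) =
    insert ⟨k, hk⟩ (Finset.univ.filter fun j : Fin D => (j : ℕ) < k) by
      ext j; simp [Fin.ext_iff]; omega]
  rw [Finset.sum_insert (by simp)]
  norm_num
  ring

theorem bigProg_runs {s : State} (h : I.Loaded x s) :
    Runs bigProg s (2 + (R * (D * 50 + 6 + 8) + 6)) fun s' => s'.realVar 10 = I.big := by
  refine Runs.seq (Runs.of_wp_le ?_ (by decide))
  have h0 : I.Loaded x (s.setReal 10 1) := by
    simpa [RExp.eval] using h.agree (Exec.setReal s 10 (.lit 1)).agree (by decide) (by decide)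
      (by decide)
  have h1 := Runs.forVar (x := 12) (y := 0) (p := bigInner) (s := s.setReal 10 1) R
    (T := D * 50 + 6) (fun k s' => s'.realVar 10 = 1 +
      ∑ i ∈ Finset.univ.filter (fun i : Fin R => (i : ℕ) < k), ∑ j, (I.Ustar i j * I.Ustar i j + 1)) h0.relays (by decide)
    (by decide) (by simp [State.setNat, State.setReal]) ?_
  · simp only [Prog.wp, RExp.eval, Int.cast_one]
    refine h1.mono le_rfl ?_
    rintro s' ⟨h2, -⟩
    simpa [big] using h2
  intro k s' hk hx ha hI
  have h' := h0.agree ha (by decide) (by decide) (by decide)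
  refine (bigInner_runs (i := ⟨k, hk⟩) h' hx).mono le_rfl ?_
  intro s'' h2
  simp only [State.setNat, h2, hI]
  rw [show (Finset.univ.filter fun j : Fin R => (j : ℕ) < k + 1) =
    insert ⟨k, hk⟩ (Finset.univ.filter fun j : Fin R => (j : ℕ) < k) by
      ext j; simp [Fin.ext_iff]; omega]
  rw [Finset.sum_insert (by simp)]
  ring

/-- The matrix is transposed with respect to the input: destinations become rows, since they are the
side to be fully matched, and relays become columns. -/
def costInner : Prog := .forVar 11 1 <|
  .branch (allowedExp (.var 12) (.var 11))
    (.putReal 10 (.var 11) (.var 12) (.sub (.lit 0) (ustarExp (.var 12) (.var 11))))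
    (.putReal 10 (.var 11) (.var 12) (.var 10))

/-- Stores the cost matrix in the real array `10`. -/
def costProg : Prog := .forVar 12 0 costInner

theorem costInner_runs {s : State} (h : I.Loaded x s) (hM : s.realVar 10 = I.big) {i : Fin R}
    (hi : s.natVar 12 = i) :
    Runs costInner s (D * 60 + 6) fun s' => (∀ j : Fin D, s'.realArr 10 j i = I.bigCost (i, j)) ∧
      ∀ r c : ℕ, c ≠ i → s'.realArr 10 r c = s.realArr 10 r c := by
  have h1 := Runs.forVar (x := 11) (y := 1) (p := .branch (allowedExp (.var 12) (.var 11))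
    (.putReal 10 (.var 11) (.var 12) (.sub (.lit 0) (ustarExp (.var 12) (.var 11))))
    (.putReal 10 (.var 11) (.var 12) (.var 10))) (s := s) D (T := 52)
    (fun k s' => (∀ j : Fin D, (j : ℕ) < k → s'.realArr 10 j i = I.bigCost (i, j)) ∧
      ∀ r c : ℕ, c ≠ i → s'.realArr 10 r c = s.realArr 10 r c) h.dests (by decide)
    (by decide) (by simp [State.setNat]) ?_
  · refine h1.mono (by omega) ?_
    rintro s' ⟨⟨h2, h3⟩, -⟩
    exact ⟨fun j => h2 j j.2, h3⟩
  rintro k s' hk hx ha ⟨hI, hI'⟩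
  refine Runs.of_wp_le ?_ (by decide)
  have h' := h.agree ha (by decide) (by decide) (by decide)
  have hi' : s'.natVar 12 = i := by rw [ha.natVar 12 (by decide), hi]
  have hM' : s'.realVar 10 = I.big := by rw [ha.realVar 10 (by decide), hM]
  simp only [Prog.wp, allowedExp_holds (e := .var 12) (f := .var 11) (j := ⟨k, hk⟩) h' hi' hx,
    NExp.eval, hi', hx, RExp.eval,
    ustarExp_eval (e := .var 12) (f := .var 11) (j := ⟨k, hk⟩) h' hi' hx]
  simp only [State.putReal, State.setNat, true_and, hM']
  have hcell : ∀ j : Fin D, (j : ℕ) = k ↔ j = ⟨k, hk⟩ := fun j => by rw [Fin.ext_iff]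
  refine ⟨fun hb => ⟨fun j hj => ?_, fun r c hc => ?_⟩, fun hb => ⟨fun j hj => ?_, fun r c hc => ?_⟩⟩
  · by_cases hjk : j = ⟨k, hk⟩
    · subst hjk; simp [bigCost, hb]
    · have : (j : ℕ) ≠ k := fun h => hjk ((hcell j).1 h)
      simp [this, hI j (by omega)]
  · simp [hc, hI' r c hc]
  · by_cases hjk : j = ⟨k, hk⟩
    · subst hjk; simp [bigCost, hb]
    · have : (j : ℕ) ≠ k := fun h => hjk ((hcell j).1 h)
      simp [this, hI j (by omega)]
  · simp [hc, hI' r c hc]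

theorem costProg_runs {s : State} (h : I.Loaded x s) (hM : s.realVar 10 = I.big) :
    Runs costProg s (R * (D * 60 + 6 + 8) + 6) fun s' =>
      ∀ (i : Fin R) (j : Fin D), s'.realArr 10 j i = I.bigCost (i, j) := by
  have h1 := Runs.forVar (x := 12) (y := 0) (p := costInner) (s := s) R
    (T := D * 60 + 6) (fun k s' => ∀ (i : Fin R) (j : Fin D), (i : ℕ) < k →
      s'.realArr 10 j i = I.bigCost (i, j)) h.relays (by decide)
    (by decide) (by simp) ?_
  · refine h1.mono le_rfl ?_
    rintro s' ⟨h2, -⟩ i j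
    exact h2 i j i.2
  intro k s' hk hx ha hI
  have h' := h.agree ha (by decide) (by decide) (by decide)
  have hM' : s'.realVar 10 = I.big := by rw [ha.realVar 10 (by decide), hM]
  refine (costInner_runs (i := ⟨k, hk⟩) h' hM' hx).mono le_rfl ?_
  rintro s'' ⟨h2, h3⟩ i j hik
  by_cases hi : i = ⟨k, hk⟩
  · subst hi; exact h2 j
  · have : (i : ℕ) ≠ k := fun h => hi (Fin.ext h)
    exact (h3 j i this).trans (hI i j (by omega))

/-! ### Writing the matching and its weight -/

/-- Writes the matching that assigns the relay in the cell `(j, 0)` of the natural array `A` to the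
destination `j`. -/
def writeMatching (A : ℕ) : Prog :=
  .seq (.forVar 12 0 (.putNat 0 (.var 12) (.lit 0) (.lit 0)))
    (.forVar 11 1 (.putNat 0 (.get A (.var 11) (.lit 0)) (.lit 0) (.add (.var 11) (.lit 1))))

theorem writeMatching_runs {s : State} (h : I.Loaded x s) {A : ℕ} (hA : A ≠ 0) {σ : Fin D → Fin R}
    (hσ : Function.Injective σ) (hs : ∀ j : Fin D, s.natArr A j 0 = σ j) :
    Runs (writeMatching A) s (R * 20 + (D * 20 + 12)) fun s' => outMatching R D s' = graphOf σ := by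
  refine Runs.mono (T := R * (4 + 8) + 6 + (D * (8 + 8) + 6)) (Runs.seq ?_) (by omega) fun _ h => h
  -- Clearing comes first because the output array may hold an earlier matching; 0 means unmatched,
  -- so destinations are stored shifted by one.
  refine (Runs.forVar R (T := 4) (fun k s' => ∀ i < k, s'.natArr 0 i 0 = 0) h.relays
    (by decide) (by decide) (by simp) ?_).mono le_rfl ?_
  · intro k s' hk hx ha hI
    refine Runs.of_wp_le ?_ (by decide)
    simp only [Prog.wp, NExp.eval, State.putNat, State.setNat, hx, true_and]
    intro i hi
    by_cases hik : i = k
    · simp [hik]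
    · simp [hik, hI i (by omega)]
  rintro s₁ ⟨h0, ha₁⟩
  have h₁ := h.agree ha₁ (by decide) (by decide) (by decide)
  have hs₁ : ∀ j : Fin D, s₁.natArr A j 0 = σ j := by
    rw [ha₁.natArr A (by simpa [Prog.forVar, Prog.natArrWrites] using hA)]; exact hs
  have h2 := Runs.forVar (x := 11) (y := 1)
    (p := .putNat 0 (.get A (.var 11) (.lit 0)) (.lit 0) (.add (.var 11) (.lit 1))) (s := s₁) D (T := 8)
    (fun k s' => ∀ (i : Fin R) (j : Fin D), s'.natArr 0 i 0 = (j : ℕ) + 1 ↔ (j : ℕ) < k ∧ σ j = i)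
    h₁.dests (by simp [Prog.natVarWrites]) (by simp [Prog.natVarWrites]) ?_ ?_
  · refine h2.mono le_rfl ?_
    rintro s₂ ⟨h3, -⟩
    ext e
    rw [mem_graphOf]
    simp only [outMatching, Finset.mem_filter, Finset.mem_univ, true_and, h3, e.2.2]
  · intro i j
    simp [State.setNat, h0 i i.2]
  · intro k s' hk hx ha hI
    refine Runs.of_wp_le ?_ (by simp [Prog.maxTime, NExp.cost])
    have hs' : s'.natArr A k 0 = σ ⟨k, hk⟩ := by
      rw [ha.natArr A (by simpa [Prog.forVar, Prog.natArrWrites] using hA)]; exact hs₁ ⟨k, hk⟩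
    simp only [Prog.wp, NExp.eval, State.putNat, State.setNat, hx, hs', true_and, and_true]
    intro i j
    -- Injectivity of `σ` ensures that writing the entry for `k` overwrites no earlier assignment.
    by_cases hi : σ ⟨k, hk⟩ = i
    · subst hi
      rw [if_pos rfl]
      constructor
      · intro hj
        have hj : j = ⟨k, hk⟩ := Fin.ext (by simpa using (by omega : (j : ℕ) = k))
        subst hj
        exact ⟨by simp, rfl⟩
      · rintro ⟨_, hj⟩
        rw [hσ hj]
    · have hne : (i : ℕ) ≠ (σ ⟨k, hk⟩ : ℕ) := fun h => hi (Fin.ext h).symm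
      rw [if_neg hne, hI i j]
      constructor
      · rintro ⟨h1, h2⟩; exact ⟨by omega, h2⟩
      · rintro ⟨h1, h2⟩
        refine ⟨?_, h2⟩
        by_contra hjk
        have hj : j = ⟨k, hk⟩ := Fin.ext (by simpa using (by omega : (j : ℕ) = k))
        subst hj
        exact hi h2

/-- Computes the weight of the matching in the natural array `10`. -/
def writeWeight : Prog :=
  .seq (.seq (.setNat 3 (.lit 0)) (.setReal 2 (.lit 0))) <| .forVar 11 1 <|
    .branch (allowedExp (.get 10 (.var 11) (.lit 0)) (.var 11))
      (.setReal 2 (.add (.var 2) (ustarExp (.get 10 (.var 11) (.lit 0)) (.var 11))))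
      (.setNat 3 (.lit 2))

theorem writeWeight_runs {s : State} (h : I.Loaded x s) {σ : Fin D → Fin R}
    (hs : ∀ j : Fin D, s.natArr 10 j 0 = σ j) :
    Runs writeWeight s (D * 60 + 10) fun s' =>
      outWeight s' = ∑ j, I.edgeWeight (σ j, j) ∧ s'.natVar 3 ≠ 1 := by
  refine Runs.mono (T := 4 + (D * (52 + 8) + 6)) (Runs.seq (Runs.of_wp_le ?_ (by decide)))
    (by omega) fun _ h => h
  simp only [Prog.wp, NExp.eval, RExp.eval, Int.cast_zero]
  have h₁ : I.Loaded x ((s.setNat 3 0).setReal 2 0) := by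
    constructor <;> simp [State.setNat, State.setReal, h.relays, h.dests, h.excl, h.revenue,
      h.threshold]
    exact h.arrays
  have h2 := Runs.forVar (x := 11) (y := 1)
    (p := .branch (allowedExp (.get 10 (.var 11) (.lit 0)) (.var 11))
      (.setReal 2 (.add (.var 2) (ustarExp (.get 10 (.var 11) (.lit 0)) (.var 11))))
      (.setNat 3 (.lit 2))) (s := (s.setNat 3 0).setReal 2 0) D (T := 52)
    -- Once the tag is 2 it stays 2, and the accumulated real value no longer matters.
    (fun k s' => (s'.natVar 3 = 0 ∧ (∀ j : Fin D, (j : ℕ) < k → I.Allowed (σ j, j)) ∧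
        s'.realVar 2 = ∑ j ∈ Finset.univ.filter (fun j : Fin D => (j : ℕ) < k), I.Ustar (σ j) j) ∨
      (s'.natVar 3 = 2 ∧ ∃ j, ¬ I.Allowed (σ j, j))) h₁.dests (by decide) (by decide) ?_ ?_
  · refine h2.mono le_rfl ?_
    rintro s' ⟨⟨h3, h4, h5⟩ | ⟨h3, j, hj⟩, -⟩
    · refine ⟨?_, by omega⟩
      rw [I.sum_edgeWeight_of_allowed (fun j => h4 j j.2), outWeight, decodeEReal, if_pos h3, h5]
      simp
    · refine ⟨?_, by omega⟩
      rw [I.sum_edgeWeight_of_not_allowed hj, outWeight, decodeEReal, h3]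
      simp
  · simp [State.setNat, State.setReal]
  intro k s' hk hx ha hI
  refine Runs.of_wp_le ?_ (by decide)
  have h' := h₁.agree ha (by decide) (by decide) (by decide)
  have hs' : s'.natArr 10 k 0 = σ ⟨k, hk⟩ := by
    rw [ha.natArr 10 (by decide)]; exact hs ⟨k, hk⟩
  have he : NExp.eval s' (.get 10 (.var 11) (.lit 0)) = σ ⟨k, hk⟩ := by
    simp [NExp.eval, hx, hs']
  have hf : NExp.eval s' (.var 11) = (⟨k, hk⟩ : Fin D) := hx
  simp only [Prog.wp, allowedExp_holds h' he hf, RExp.eval, ustarExp_eval h' he hf, NExp.eval,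
    State.setNat, State.setReal, Function.update_apply]
  rw [show (Finset.univ.filter fun j : Fin D => (j : ℕ) < k + 1) =
    insert ⟨k, hk⟩ (Finset.univ.filter fun j : Fin D => (j : ℕ) < k) by
      ext j; simp [Fin.ext_iff]; omega, Finset.sum_insert (by simp)]
  refine ⟨fun hb => ?_, fun hb => Or.inr ⟨by simp, _, hb⟩⟩
  rcases hI with ⟨h3, h4, h5⟩ | ⟨h3, h4⟩
  · refine Or.inl ⟨by simpa using h3, fun j hj => ?_, ?_⟩
    · by_cases hjk : j = ⟨k, hk⟩
      · subst hjk; exact hb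
      · exact h4 j (lt_of_le_of_ne (by omega) fun h => hjk (Fin.ext h))
    · simp [h5, add_comm]
  · exact Or.inr ⟨by simpa using h3, h4⟩

end Instance

end BSAuction

namespace BSAuction

namespace Instance

variable {R D : ℕ} {I : Instance R D}

/-! ### A single matching computation -/

/-- The number that stands for the excluded relay. -/
def exclIndex : Option (Fin R) → ℕ
  | none => R
  | some i => i

theorem loaded_load (x : Option (Fin R)) : I.Loaded (exclIndex x) (I.load x) where
  relays := rfl
  dests := rfl
  excl := by cases x <;> rfl
  revenue := rfl
  threshold := rfl
  arrays _ _ := rfl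

theorem Loaded.setExcl {x : ℕ} {s : State} (h : I.Loaded x s) (y : ℕ) :
    I.Loaded y (s.setNat 2 y) where
  relays := by simp [State.setNat, h.relays]
  dests := by simp [State.setNat, h.dests]
  excl := by simp [State.setNat]
  revenue := h.revenue
  threshold := h.threshold
  arrays := h.arrays

/-- The index `R` stands for no exclusion, since it is not a column anyway. -/
theorem coe_mem_columns {x : Option (Fin R)} {i : Fin R} :
    (i : ℕ) ∈ Hungarian.columns R (exclIndex x) ↔ some i ≠ x := by
  rw [Hungarian.mem_columns]
  cases x with
  | none => simp [exclIndex, i.2.ne]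
  | some k => simp [exclIndex, Fin.ext_iff]

/-- Computes a maximal matching of largest weight and its weight. -/
def matchProg : Prog :=
  .seq bigProg <| .seq costProg <| .seq Hungarian.hungarian <| .seq (writeMatching 10) writeWeight

/-- Besides the output, the postcondition retains the assignment in array 10, which the auction
copies, and that the tag is not `1`, so that a nonzero tag means `-∞`. -/
theorem matchProg_runs (hD : 1 ≤ D) (hDR : D < R) {x : Option (Fin R)} {s : State}
    (h : I.Loaded (exclIndex x) s) :
    Runs matchProg s (3000 * (D * (D * R))) fun s' => ∃ σ : Fin D → Fin R, IsAssignment x σ ∧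
      (∀ j : Fin D, s'.natArr 10 j 0 = σ j) ∧ outMatching R D s' = graphOf σ ∧
      I.IsOptimal (edgesExcluding D x) (graphOf σ) ∧
      outWeight s' = I.maxWeight (edgesExcluding D x) ∧ s'.natVar 3 ≠ 1 := by
  have hbound : (2 + (R * (D * 50 + 6 + 8) + 6)) + ((R * (D * 60 + 6 + 8) + 6) +
      (D * (D * (R * 2000)) + ((R * 20 + (D * 20 + 12)) + (D * 60 + 10)))) ≤
      3000 * (D * (D * R)) := by
    have h1 : 1 * R ≤ D * R := Nat.mul_le_mul_right R hD
    have h2 : 1 * (D * R) ≤ D * (D * R) := Nat.mul_le_mul_right _ hD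
    have e1 : R * (D * 50 + 6 + 8) = 50 * (D * R) + 14 * R := by ring
    have e2 : R * (D * 60 + 6 + 8) = 60 * (D * R) + 14 * R := by ring
    have e3 : D * (D * (R * 2000)) = 2000 * (D * (D * R)) := by ring
    omega
  refine Runs.mono ?_ hbound fun _ h => h
  refine Runs.seq ((bigProg_runs h).frame.mono le_rfl ?_)
  rintro s₁ ⟨hM₁, ha₁⟩
  have h₁ := h.agree ha₁ (by decide) (by decide) (by decide)
  refine Runs.seq ((costProg_runs h₁ hM₁).frame.mono le_rfl ?_)
  rintro s₂ ⟨hc₂, ha₂⟩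
  have h₂ := h₁.agree ha₂ (by decide) (by decide) (by decide)
  have hM₂ : s₂.realVar 10 = I.big := by rw [ha₂.realVar 10 (by decide), hM₁]
  have henv : Hungarian.Env (s₂.realArr 10) R D (exclIndex x) s₂ :=
    ⟨h₂.dests, h₂.relays, h₂.excl, rfl⟩
  -- At least `R - 1 ≥ D` columns remain after the exclusion.
  have hcard : D ≤ (Hungarian.columns R (exclIndex x)).card := by
    have := Finset.pred_card_le_card_erase (s := Finset.range R) (a := exclIndex x)
    rw [Finset.card_range] at this
    exact (Nat.le_sub_one_of_lt hDR).trans this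
  have hlow : ∀ r < D, ∀ c < R, -I.big ≤ s₂.realArr 10 r c := fun r hr c hc => by
    rw [hc₂ ⟨c, hc⟩ ⟨r, hr⟩]; exact I.neg_big_le_bigCost _
  refine Runs.seq ((Hungarian.hungarian_runs henv hDR.le hD hcard hM₂ hlow).frame.mono le_rfl ?_)
  rintro s₃ ⟨hd, ha₃⟩
  have h₃ := h₂.agree ha₃ (by decide) (by decide) (by decide)
  let σ : Fin D → Fin R := fun j =>
    ⟨s₃.natArr 10 j 0, (Hungarian.mem_columns.1 (hd.mem j j.2)).2⟩
  have hσ : IsAssignment x σ := by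
    refine ⟨fun j k hjk => Fin.ext (hd.inj j j.2 k k.2 (congrArg Fin.val hjk)), fun j => ?_⟩
    exact coe_mem_columns.1 (hd.mem j j.2)
  have hopt : I.IsOptimal (edgesExcluding D x) (graphOf σ) := by
    refine I.isOptimal_graphOf hDR hσ fun τ hτ => I.sum_edgeWeight_le_of_sum_bigCost_le ?_
    -- The competitor is extended to all natural numbers; the default 0 beyond `D` is never used.
    have key := hd.optimal (σ := fun r => if hr : r < D then (τ ⟨r, hr⟩ : ℕ) else 0) ?_ ?_
    · rw [Finset.sum_range, Finset.sum_range] at key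
      simp only [Fin.is_lt, dif_pos, Fin.eta] at key
      have e1 : ∀ j : Fin D, s₂.realArr 10 j (s₃.natArr 10 j 0) = I.bigCost (σ j, j) :=
        fun j => hc₂ (σ j) j
      simpa only [e1, hc₂] using key
    · intro r hr
      rw [dif_pos hr]
      exact coe_mem_columns.2 (hτ.2 _)
    · intro r hr r' hr' e
      rw [dif_pos hr, dif_pos hr'] at e
      exact congrArg Fin.val (hτ.1 (Fin.ext e))
  refine Runs.seq ((writeMatching_runs h₃ (by decide) hσ.1 (fun _ => rfl)).frame.mono le_rfl ?_)
  rintro s₄ ⟨hm₄, ha₄⟩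
  have h₄ := h₃.agree ha₄ (by decide) (by decide) (by decide)
  have hq₄ : ∀ j : Fin D, s₄.natArr 10 j 0 = σ j := fun j => by rw [ha₄.natArr 10 (by decide)]
  refine (writeWeight_runs h₄ hq₄).frame.mono le_rfl ?_
  rintro s₅ ⟨⟨hw, ht⟩, ha₅⟩
  refine ⟨σ, hσ, fun j => by rw [ha₅.natArr 10 (by decide), hq₄], ?_, hopt, ?_, ht⟩
  · rw [← hm₄, outMatching, outMatching, ha₅.natArr 0 (by decide)]
  · rw [hw, hopt.maxWeight_eq, weight_graphOf]

theorem outWeight_eq_of_ne_bot {s : State} (h1 : s.natVar 3 ≠ 1) (h : outWeight s ≠ ⊥) :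
    outWeight s = (s.realVar 2 : EReal) := by
  rw [outWeight, decodeEReal] at h ⊢
  split_ifs at h ⊢ with h0
  · rfl
  · exact absurd rfl h

/-! ### Payments and powers -/

/-- Saves the weight and the matching. -/
def saveProg : Prog := .seq (.setReal 20 (.var 2)) <|
  .forVar 11 1 (.putNat 20 (.var 11) (.lit 0) (.get 10 (.var 11) (.lit 0)))

/-- Computes the payment and the power of the relay that serves the destination in the natural
variable `21`. -/
def payTail : Prog :=
  .seq (.branch (.natEq (.var 3) (.lit 0))
      (.putReal 5 (.var 2) (.lit 0) (.add (.sub (.var 20) (.var 2))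
        (.mul (.get 0 (.var 2) (.lit 0)) (.add (.get 2 (.var 2) (.var 21)) (.get 1 (.var 2) (.lit 0))))))
      (.putNat 1 (.var 2) (.lit 0) (.lit 1)))
    (.putReal 6 (.var 2) (.lit 0) (.get 2 (.var 2) (.var 21)))

/-- The served relay becomes the excluded one in variable 2, so the same matching program computes
`w_max^{-i}`. -/
def payBody : Prog :=
  .seq (.setNat 2 (.get 20 (.var 21) (.lit 0))) <| .seq matchProg payTail

/-- Computes the auction. -/
def auctionProg : Prog := .seq matchProg <| .seq saveProg <| .seq (.forVar 21 1 payBody) <|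
  writeMatching 20

theorem saveProg_runs {x : ℕ} {s : State} (h : I.Loaded x s) :
    Runs saveProg s (D * 20 + 10) fun s' => s'.realVar 20 = s.realVar 2 ∧
      ∀ j < D, s'.natArr 20 j 0 = s.natArr 10 j 0 := by
  refine Runs.mono (T := 4 + (D * (10 + 8) + 6)) (Runs.seq (Runs.of_wp_le ?_ (by decide)))
    (by omega) fun _ h => h
  simp only [Prog.wp, RExp.eval]
  refine (Runs.forVar (s := s.setReal 20 (s.realVar 2)) D (T := 10) (fun k s' => ∀ j < k, s'.natArr 20 j 0 = s.natArr 10 j 0)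
    h.dests (by decide) (by decide) (by simp) ?_).mono le_rfl ?_
  · intro k s' hk hx ha hI
    refine Runs.of_wp_le ?_ (by decide)
    simp only [Prog.wp, NExp.eval, State.putNat, State.setNat, hx, true_and]
    intro j hj
    have h10 : s'.natArr 10 = s.natArr 10 := ha.natArr 10 (by decide)
    by_cases hjk : j = k
    · simp [hjk, h10]
    · simp [hjk, hI j (by omega)]
  · rintro s' ⟨h1, ha⟩
    refine ⟨?_, h1⟩
    rw [ha.realVar 20 (by decide)]
    simp [State.setReal]

/-- The tag is written only for an infinite payment, so a finite one relies on the tag cell still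
being 0. The payment is expressed through the saved real number, so finiteness of `w_max` is not
needed here. -/
theorem payBody_runs (hD : 1 ≤ D) (hDR : D < R) {x : ℕ} {s : State} (h : I.Loaded x s) {i : Fin R}
    {j : Fin D} (hj : s.natVar 21 = j) (hi : s.natArr 20 j 0 = i) (htag : s.natArr 1 i 0 = 0) :
    Runs payBody s (3000 * (D * (D * R)) + 50) fun s' => I.Loaded i s' ∧
      (∀ k : ℕ, k ≠ i → s'.natArr 1 k 0 = s.natArr 1 k 0 ∧ s'.realArr 5 k 0 = s.realArr 5 k 0 ∧
        s'.realArr 6 k 0 = s.realArr 6 k 0) ∧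
      outPower R s' i = I.Pstar i j ∧
      outPay R s' i = (s.realVar 20 : EReal) - I.wMaxWithout i +
        ((I.α i * (I.Pstar i j + I.Pc i) : ℝ) : EReal) := by
  refine Runs.mono (T := 5 + (3000 * (D * (D * R)) + 40)) (Runs.seq (Runs.of_wp_le ?_ (by decide)))
    (by omega) fun _ h => h
  simp only [Prog.wp, NExp.eval, hj, hi]
  refine Runs.seq ((matchProg_runs (x := some i) hD hDR (h.setExcl _)).frame.mono le_rfl ?_)
  rintro s₁ ⟨⟨σ, -, -, -, -, hw, ht⟩, ha⟩
  refine Runs.of_wp_le ?_ (by decide)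
  have h₁ : I.Loaded i s₁ := (h.setExcl _).agree ha (by decide) (by decide) (by decide)
  have h21 : s₁.natVar 21 = j := by
    rw [ha.natVar 21 (by decide)]; simpa [State.setNat] using hj
  have hr20 : s₁.realVar 20 = s.realVar 20 := ha.realVar 20 (by decide)
  have hn1 : s₁.natArr 1 = s.natArr 1 := ha.natArr 1 (by decide)
  have hr5 : s₁.realArr 5 = s.realArr 5 := ha.realArr 5 (by decide)
  have hr6 : s₁.realArr 6 = s.realArr 6 := ha.realArr 6 (by decide)
  have hP : s₁.realArr 2 i j = I.Pstar i j := by simp [h₁.arrays, load, pad]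
  have hα : s₁.realArr 0 i 0 = I.α i := by simp [h₁.arrays, load, pad]
  have hPc : s₁.realArr 1 i 0 = I.Pc i := by simp [h₁.arrays, load, pad]
  have hw' : outWeight s₁ = I.wMaxWithout i := by rw [I.wMaxWithout_eq hDR, hw]; rfl
  refine ⟨fun hb => ?_, fun hb => ?_⟩
  · simp only [BExp.Holds, NExp.eval] at hb
    have hwi : I.wMaxWithout i = (s₁.realVar 2 : EReal) := by
      rw [← hw', outWeight, decodeEReal, if_pos hb]
    simp only [Prog.wp, NExp.eval, RExp.eval, State.putReal, h₁.excl, h21, hP, hα, hPc, hr20,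
      outPower, outPay, hn1, hr5, hr6, htag, hwi, decodeEReal]
    refine ⟨⟨h₁.relays, h₁.dests, h₁.excl, h₁.revenue, h₁.threshold, ?_⟩, ?_, by simp, ?_⟩
    · intro A hA
      rw [← h₁.arrays A hA]
      funext k l
      simp [show A ≠ 5 by omega, show A ≠ 6 by omega]
    · intro k hk
      simp [hk]
    · simp
  · simp only [BExp.Holds, NExp.eval] at hb
    have hwi : I.wMaxWithout i = ⊥ := by
      rw [← hw', outWeight, decodeEReal, if_neg hb, if_neg ht]
    simp only [Prog.wp, NExp.eval, RExp.eval, State.putReal, State.putNat, h₁.excl, h21, hP,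
      outPower, outPay, hn1, hr5, hr6, hwi, decodeEReal]
    refine ⟨⟨h₁.relays, h₁.dests, h₁.excl, h₁.revenue, h₁.threshold, ?_⟩, ?_, by simp, ?_⟩
    · intro A hA
      rw [← h₁.arrays A hA]
      funext k l
      simp [show A ≠ 6 by omega]
    · intro k hk
      simp [hk]
    · simp only [and_self, if_true, one_ne_zero, if_false]
      -- A real number minus `-∞` is `+∞`, and adding a real number does not change this; tag `1`
      -- encodes it.
      rw [EReal.coe_sub_bot, EReal.top_add_coe]

theorem auctionProg_runs (hD : 1 ≤ D) (hDR : D < R) :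
    Runs auctionProg (I.load none) (10000 * (D * (D * (D * R)))) fun s =>
      I.IsOutcome (outMatching R D s) (outPay R s) (outPower R s) := by
  have hbound : 3000 * (D * (D * R)) + ((D * 20 + 10) +
      ((D * (3000 * (D * (D * R)) + 50 + 8) + 6) + (R * 20 + (D * 20 + 12)))) ≤
      10000 * (D * (D * (D * R))) := by
    have h1 : 1 * R ≤ D * R := Nat.mul_le_mul_right R hD
    have h2 : 1 * (D * R) ≤ D * (D * R) := Nat.mul_le_mul_right _ hD
    have h3 : 1 * (D * (D * R)) ≤ D * (D * (D * R)) := Nat.mul_le_mul_right _ hD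
    have e1 : D * (3000 * (D * (D * R)) + 50 + 8) = 3000 * (D * (D * (D * R))) + 58 * D := by ring
    omega
  refine Runs.mono ?_ hbound fun _ h => h
  have h : I.Loaded (exclIndex none) (I.load none) := loaded_load none
  refine Runs.seq ((matchProg_runs hD hDR h).frame.mono le_rfl ?_)
  rintro s₁ ⟨⟨σ, hσ, hq, -, hopt, hw, ht⟩, ha₁⟩
  have h₁ := h.agree ha₁ (by decide) (by decide) (by decide)
  refine Runs.seq ((saveProg_runs h₁).frame.mono le_rfl ?_)
  rintro s₂ ⟨⟨hw₂, hq₂⟩, ha₂⟩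
  have h₂ := h₁.agree ha₂ (by decide) (by decide) (by decide)
  have hσ₂ : ∀ j : Fin D, s₂.natArr 20 j 0 = σ j := fun j => by rw [hq₂ j j.2, hq]
  have hzero : ∀ k, s₂.natArr 1 k 0 = 0 ∧ s₂.realArr 5 k 0 = 0 ∧ s₂.realArr 6 k 0 = 0 := fun k => by
    rw [ha₂.natArr 1 (by decide), ha₂.realArr 5 (by decide), ha₂.realArr 6 (by decide),
      ha₁.natArr 1 (by decide), ha₁.realArr 5 (by decide), ha₁.realArr 6 (by decide)]
    exact ⟨rfl, rfl, rfl⟩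
  -- The excluded index changes in each round, hence the existential. The zeros kept for relays not
  -- yet treated give both the clean tag for the next winner and the final results of the losers.
  refine Runs.seq ((Runs.forVar D (T := 3000 * (D * (D * R)) + 50) (fun k s' => (∃ x, I.Loaded x s') ∧
    (∀ j : Fin D, (j : ℕ) < k → outPower R s' (σ j) = I.Pstar (σ j) j ∧
      outPay R s' (σ j) = (s₂.realVar 20 : EReal) - I.wMaxWithout (σ j) +
        ((I.α (σ j) * (I.Pstar (σ j) j + I.Pc (σ j)) : ℝ) : EReal)) ∧
    ∀ i : Fin R, (∀ j : Fin D, (j : ℕ) < k → σ j ≠ i) →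
      s'.natArr 1 i 0 = 0 ∧ s'.realArr 5 i 0 = 0 ∧ s'.realArr 6 i 0 = 0)
    h₂.dests (by decide) (by decide) ?_ ?_).mono le_rfl ?_)
  · exact ⟨⟨_, h₂.agree (Exec.setNat s₂ 21 (.lit 0)).agree (by decide) (by decide) (by decide)⟩,
      by simp, fun i _ => hzero i⟩
  · rintro k s' hk hx ha ⟨⟨x, hl⟩, hI, hI'⟩
    -- By injectivity the next relay has not been treated before, and its payment will not overwrite
    -- an earlier one.
    have hnew : ∀ j : Fin D, (j : ℕ) < k → σ j ≠ σ ⟨k, hk⟩ := fun j hj e => by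
      rw [hσ.1 e] at hj
      exact lt_irrefl _ hj
    refine (payBody_runs (i := σ ⟨k, hk⟩) (j := ⟨k, hk⟩) hD hDR hl hx ?_ (hI' _ hnew).1).mono
      le_rfl ?_
    · rw [ha.natArr 20 (by decide)]; exact hσ₂ ⟨k, hk⟩
    rintro s'' ⟨hl', hrest, hpow, hpay⟩
    have hr20 : s'.realVar 20 = s₂.realVar 20 := ha.realVar 20 (by decide)
    rw [hr20] at hpay
    refine ⟨⟨_, hl'.agree (Exec.setNat s'' 21 (.lit (k + 1))).agree (by simp [Prog.natVarWrites])
      (by simp [Prog.realVarWrites]) (by simp [Prog.realArrWrites])⟩, ?_, ?_⟩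
    · intro j hj
      by_cases hjk : j = ⟨k, hk⟩
      · subst hjk; exact ⟨hpow, hpay⟩
      · have hjk' : (j : ℕ) < k := lt_of_le_of_ne (by omega) fun e => hjk (Fin.ext e)
        have hne : (σ j : ℕ) ≠ σ ⟨k, hk⟩ := fun e => hnew j hjk' (Fin.ext e)
        have := hI j hjk'
        simp only [outPower, outPay] at this ⊢
        simp only [State.setNat, hrest _ hne]
        exact this
    · intro i hi
      have hne : (i : ℕ) ≠ σ ⟨k, hk⟩ := fun e => hi ⟨k, hk⟩ (by simp) (Fin.ext e).symm
      simp only [State.setNat, hrest _ hne]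
      exact hI' i fun j hj => hi j (by omega)
  rintro s₃ ⟨⟨⟨x, h₃⟩, hwin, hlose⟩, ha₃⟩
  have hσ₃ : ∀ j : Fin D, s₃.natArr 20 j 0 = σ j := fun j => by
    rw [ha₃.natArr 20 (by decide)]; exact hσ₂ j
  -- The matchings computed for the payments have overwritten the output array; the saved one is
  -- written back.
  refine (writeMatching_runs h₃ (by decide) hσ.1 hσ₃).frame.mono le_rfl ?_
  rintro s₄ ⟨hm, ha₄⟩
  have hpay : outPay R s₄ = outPay R s₃ := by
    funext i
    rw [outPay, outPay, ha₄.natArr 1 (by decide), ha₄.realArr 5 (by decide)]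
  have hpow : outPower R s₄ = outPower R s₃ := by
    funext i
    rw [outPower, outPower, ha₄.realArr 6 (by decide)]
  have hnot : ∀ i, i ∉ relaysOf (graphOf σ) → ∀ j : Fin D, (j : ℕ) < D → σ j ≠ i :=
    fun i hi j _ e => hi (mem_relaysOf_graphOf.2 ⟨j, e⟩)
  rw [hm, hpay, hpow]
  refine ⟨hopt, fun hne i j hij => ?_, fun i hi => ?_, fun i j hij => ?_, fun i hi => ?_⟩
  · obtain rfl : σ j = i := mem_graphOf.1 hij
    have hmax : I.wMax = outWeight s₁ := hw.symm
    -- Only here is `w_max ≠ -∞` used: then the saved real number is `w_max` itself.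
    rw [(hwin j j.2).2, hw₂, hmax, outWeight_eq_of_ne_bot ht (by rwa [← hmax])]
  · obtain ⟨h1, h2, -⟩ := hlose i (hnot i hi)
    rw [outPay, h1, h2, decodeEReal, if_pos rfl, EReal.coe_zero]
  · obtain rfl : σ j = i := mem_graphOf.1 hij
    exact (hwin j j.2).1
  · exact (hlose i (hnot i hi)).2.2

end Instance

/-- The logarithmic term is nonnegative because `R + D ≥ 1`, and `D²R` is one of the two summands of
`(R+D)RD`. -/
theorem le_hungarianTime {R D : ℕ} (hD : 1 ≤ D) (hDR : D < R) :
    ((D * (D * R) : ℕ) : ℝ) ≤ hungarianTime R D := by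
  have hR : (1 : ℝ) ≤ R := by exact_mod_cast (hD.trans hDR.le)
  have hD' : (1 : ℝ) ≤ D := by exact_mod_cast hD
  have h1 : 0 ≤ ((R : ℝ) + D) ^ 2 * Real.log ((R : ℝ) + D) :=
    mul_nonneg (sq_nonneg _) (Real.log_nonneg (by linarith))
  have h2 : (0 : ℝ) ≤ R * R * D := by positivity
  rw [hungarianTime]
  push_cast
  nlinarith

end BSAuction

theorem mainTheorem5 :
    ∃ (matchProg auctionProg : RealRAM.Prog) (c : ℝ),
      ∀ (R D : ℕ), 1 ≤ D → D < R → ∀ I : BSAuction.Instance R D,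
        -- the auction is computed in time `O(D 𝓗)`
        (∃ (s : RealRAM.State) (t : ℕ),
          RealRAM.Exec auctionProg (I.load none) s t ∧
          (t : ℝ) ≤ c * ((D : ℝ) * BSAuction.hungarianTime R D) ∧
          I.IsOutcome (BSAuction.outMatching R D s) (BSAuction.outPay R s)
            (BSAuction.outPower R s)) ∧
        -- one matching computation, on `G` or on `G` without a relay, takes time `O(𝓗)`
        (∀ excl : Option (Fin R), ∃ (s : RealRAM.State) (t : ℕ),
          RealRAM.Exec matchProg (I.load excl) s t ∧
          (t : ℝ) ≤ c * BSAuction.hungarianTime R D ∧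
          I.IsOptimal (BSAuction.edgesExcluding D excl) (BSAuction.outMatching R D s) ∧
          BSAuction.outWeight s = I.maxWeight (BSAuction.edgesExcluding D excl)) ∧
        -- the optimum on `G` without relay `i` is `w_max^{-i}`
        (∀ i : Fin R, I.wMaxWithout i = I.maxWeight (BSAuction.edgesWithout D i)) := by
  -- The constant of the auction; the matching program alone needs only 3000.
  refine ⟨BSAuction.Instance.matchProg, BSAuction.Instance.auctionProg, 10000, ?_⟩
  intro R D hD hDR I
  have hH := BSAuction.le_hungarianTime hD hDR
  refine ⟨?_, fun excl => ?_, I.wMaxWithout_eq hDR⟩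
  · obtain ⟨s, t, he, ht, ho⟩ := BSAuction.Instance.auctionProg_runs (I := I) hD hDR
    refine ⟨s, t, he, ?_, ho⟩
    have ht' : (t : ℝ) ≤ 10000 * (D * ((D * (D * R) : ℕ) : ℝ)) := by exact_mod_cast ht
    exact ht'.trans (by gcongr)
  · obtain ⟨s, t, he, ht, σ, -, -, hm, hopt, hw, -⟩ :=
      BSAuction.Instance.matchProg_runs hD hDR (BSAuction.Instance.loaded_load (I := I) excl)
    refine ⟨s, t, he, ?_, by rwa [hm], hw⟩
    have ht' : (t : ℝ) ≤ 3000 * ((D * (D * R) : ℕ) : ℝ) := by exact_mod_cast ht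
    have : (0 : ℝ) ≤ ((D * (D * R) : ℕ) : ℝ) := by positivity
    linarith
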